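/- Let $p$ be a prime and $k$ an algebraically closed field of characteristic $p$. For a finite group $X$ write $B_0(kX)$ for the principal block of $kX$. For a subgroup $Y\le X$ let $\mathrm{Sc}(X,Y)$ be the Scott module, i.e. the (up to isomorphism unique) indecomposable direct summand of the induced module $k_Y{\uparrow}^X$ that has the trivial module $k_X$ in its top. A $kX$-module $V$ is called *Brauer indecomposable* if for every $p$-subgroup $Q\le X$ the Brauer quotient $$V(Q)=V^Q\Big/\sum_{R<Q}\mathrm{Tr}^Q_R(V^R),$$ a $kN_X(Q)$-module, restricts to an indecomposable or zero $kC_X(Q)$-module. Let $G$ and $H$ be finite groups. A $(kG,kH)$-bimodule $M$ is regarded as a module for $G\times H$ through $m\cdot(g,h)=g^{-1}mh$; it *induces a splendid Morita equivalence* between $B_0(kG)$ and $B_0(kH)$ if it is a $(B_0(kG),B_0(kH))$-bimodule inducing a Morita equivalence between these algebras and is a $p$-permutation $k[G\times H]$-module. Suppose that $G$ and $H$ have a common Sylow $p$-subgroup $P$ (a group $P$ embedded as a Sylow $p$-subgroup in both), and let $\Delta P=\{(x,x): x\in P\}\le G\times H$. If $\mathrm{Sc}(G\times H,\Delta P)$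 induces a splendid Morita equivalence between $B_0(kG)$ and $B_0(kH)$, then $\mathrm{Sc}(G\times H,\Delta P)$ is Brauer indecomposable. In particular, let $p=2$, $n\ge 3$, let $P\cong Q_{2^n}$ be generalised quaternion of order $2^n$, and let $H$ be one of the groups $Q_{2^n}$, $2.\mathfrak A_7$, $\mathrm{SL}_2(q)$ or $2.\mathrm{PGL}_2(q)$ with $q$ an odd prime power, where $2.\mathfrak A_7$ is the perfect central extension of $\mathfrak A_7$ by $C_2$ and $2.\mathrm{PGL}_2(q)$ is the central extension of $\mathrm{PGL}_2(q)$ by $C_2$ with generalised quaternion Sylow $2$-subgroups. If $P$ is a common Sylow $2$-subgroup of $G$ and $H$ and $\mathrm{Sc}(G\times H,\Delta P)$ realises a splendid Morita equivalence between $B_0(kG)$ and $B_0(kH)$, then $\mathrm{Sc}(G\times H,\Delta P)$ is Brauer indecomposable. -/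

import Mathlib

/-! Modules over group algebras are given as linear representations.  A right `kG`-module is
regarded as a left one through `g • m = m g⁻¹`; in particular a `(kG, kH)`-bimodule `M` is the
representation of `G × H` on `M` given by `(g, h) • m = g m h⁻¹`. -/

universe u v₁ v₂ v₃ w

namespace BlockTheory

noncomputable section

open scoped TensorProduct

section Modules

variable {k : Type*} [Field k] {G : Type*} [Group G] {V : Type*} [AddCommGroup V] [Module k V]
  {W : Type*} [AddCommGroup W] [Module k W]

/-- A nonzero module that is not the direct sum of two nonzero submodules. -/
def IsIndecomposable (ρ : Representation k G V) : Prop :=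
  Nontrivial V ∧ ∀ X Y : Subrepresentation ρ, IsCompl X Y → X = ⊥ ∨ Y = ⊥

/-- `ρ` is isomorphic to a direct summand of `σ`. -/
def IsDirectSummand (ρ : Representation k G V) (σ : Representation k G W) : Prop :=
  ∃ (ι : Representation.IntertwiningMap ρ σ) (π : Representation.IntertwiningMap σ ρ),
    ∀ v, π (ι v) = v

/-- `ρ` is a Scott module `Sc(G, Q)`: an indecomposable direct summand of the induced module
`k_Q↑^G` whose top has the trivial module `k_G` as a constituent, that is, which has `k_G` as a
quotient.  This determines `ρ` up to isomorphism. -/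
def IsScottModule (ρ : Representation k G V) (Q : Subgroup G) : Prop :=
  IsIndecomposable ρ ∧
  IsDirectSummand ρ (Representation.ind Q.subtype (Representation.trivial k Q k)) ∧
  ∃ φ : Representation.IntertwiningMap ρ (Representation.trivial k G k), Function.Surjective φ

/-- `p`-permutation modules: finitely generated, and for every `p`-subgroup `Q` there is a
`k`-basis that is permuted by `Q`. -/
def IsPPermutation (p : ℕ) (ρ : Representation k G V) : Prop :=
  ∀ Q : Subgroup G, IsPGroup p Q →
    ∃ (n : ℕ) (b : Module.Basis (Fin n) k V), ∀ q ∈ Q, ∀ i, ∃ j, ρ q (b i) = b j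

end Modules

section BrauerConstruction

variable {k : Type*} [Field k] {G : Type*} [Group G] {V : Type*} [AddCommGroup V] [Module k V]

/-- The fixed points `V^R`. -/
def fixedPoints (ρ : Representation k G V) (R : Subgroup G) : Submodule k V :=
  Representation.invariants (ρ.comp R.subtype)

theorem mem_fixedPoints {ρ : Representation k G V} {R : Subgroup G} {v : V} :
    v ∈ fixedPoints ρ R ↔ ∀ r ∈ R, ρ r v = v := by
  simp [fixedPoints, Representation.mem_invariants]

/-- The relative trace `v ↦ ∑_{xR ∈ Q/R} x v` for `R ≤ Q`, written with a chosen system of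
representatives of `Q/R`; it is only ever applied to vectors of `V^R`, where the choice does not
matter (`relTrace_apply`). -/
def relTrace (ρ : Representation k G V) (R Q : Subgroup G) : V →ₗ[k] V :=
  ∑ᶠ x : Q ⧸ R.subgroupOf Q, ρ ((Quotient.out x : Q) : G)

/-- `∑_{R < Q} Tr^Q_R (V^R)`. -/
def traceSubmodule (ρ : Representation k G V) (Q : Subgroup G) : Submodule k V :=
  ⨆ (R : Subgroup G) (_ : R < Q), (fixedPoints ρ R).map (relTrace ρ R Q)

theorem rho_eq_of_mk_eq {ρ : Representation k G V} {R Q : Subgroup G} {v : V}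
    (hv : v ∈ fixedPoints ρ R) {x y : Q}
    (h : (QuotientGroup.mk x : Q ⧸ R.subgroupOf Q) = QuotientGroup.mk y) :
    ρ (x : G) v = ρ (y : G) v := by
  have h1 : ((x⁻¹ * y : Q) : G) ∈ R := Subgroup.mem_subgroupOf.1 (QuotientGroup.eq.1 h)
  have h2 := mem_fixedPoints.1 hv _ h1
  conv_lhs => rw [← h2]
  rw [← Module.End.mul_apply, ← map_mul]
  simp

theorem relTrace_apply [Finite G] (ρ : Representation k G V) (R Q : Subgroup G) {v : V}
    (hv : v ∈ fixedPoints ρ R) (s : Q ⧸ R.subgroupOf Q → Q)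
    (hs : ∀ x, QuotientGroup.mk (s x) = x) :
    relTrace ρ R Q v = ∑ᶠ x : Q ⧸ R.subgroupOf Q, ρ (s x : G) v := by
  have h : relTrace ρ R Q v = ∑ᶠ x : Q ⧸ R.subgroupOf Q, ρ ((Quotient.out x : Q) : G) v :=
    ((LinearMap.applyₗ (R := k) v).toAddMonoidHom : (V →ₗ[k] V) →+ V).map_finsum
      (Set.toFinite _)
  rw [h]
  refine finsum_congr fun x => rho_eq_of_mk_eq hv ?_
  rw [hs x]
  exact Quotient.out_eq' x

theorem rho_mem_fixedPoints_map {ρ : Representation k G V} {R : Subgroup G} {v : V}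
    (hv : v ∈ fixedPoints ρ R) (g : G) :
    ρ g v ∈ fixedPoints ρ (R.map (MulAut.conj g).toMonoidHom) := by
  rw [mem_fixedPoints] at hv ⊢
  rintro _ ⟨r, hr, rfl⟩
  have : ρ (g * r * g⁻¹ * g) v = ρ g v := by simp [hv r hr]
  simpa using this

theorem rho_mem_fixedPoints {ρ : Representation k G V} {Q : Subgroup G} {g : G}
    (hg : g ∈ Subgroup.normalizer (Q : Set G)) {v : V} (hv : v ∈ fixedPoints ρ Q) :
    ρ g v ∈ fixedPoints ρ Q := by
  have := rho_mem_fixedPoints_map hv g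
  rwa [show Q.map (MulAut.conj g).toMonoidHom = Q from
    Subgroup.mem_normalizer_iff_map_conj_eq.1 hg] at this

theorem rho_relTrace [Finite G] {ρ : Representation k G V} {R Q : Subgroup G} {g : G}
    (hg : g ∈ Subgroup.normalizer (Q : Set G)) {v : V} (hv : v ∈ fixedPoints ρ R) :
    ρ g (relTrace ρ R Q v) =
      relTrace ρ (R.map (MulAut.conj g).toMonoidHom) Q (ρ g v) := by
  have hgQ := Subgroup.mem_normalizer_iff.1 hg
  have key : ∀ a : G, g * a * g⁻¹ ∈ R.map (MulAut.conj g).toMonoidHom ↔ a ∈ R := by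
    intro a
    exact Subgroup.mem_map_iff_mem (f := (MulAut.conj g).toMonoidHom) (MulAut.conj g).injective
  let c : Q → Q := fun a => ⟨g * a * g⁻¹, (hgQ a).1 a.2⟩
  have hc : ∀ a b : Q, (c a)⁻¹ * c b ∈
      (R.map (MulAut.conj g).toMonoidHom).subgroupOf Q ↔ a⁻¹ * b ∈ R.subgroupOf Q := by
    intro a b
    rw [Subgroup.mem_subgroupOf, Subgroup.mem_subgroupOf, ← key]
    simp [c, mul_assoc]
  have hout : ∀ x : Q ⧸ R.subgroupOf Q, QuotientGroup.mk (Quotient.out x) = x :=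
    fun x => Quotient.out_eq' x
  have hout' : ∀ x : Q ⧸ (R.map (MulAut.conj g).toMonoidHom).subgroupOf Q,
    QuotientGroup.mk (Quotient.out x) = x := fun x => Quotient.out_eq' x
  have hmap : ρ g (∑ᶠ x : Q ⧸ R.subgroupOf Q, ρ ((Quotient.out x : Q) : G) v) =
      ∑ᶠ x : Q ⧸ R.subgroupOf Q, ρ g (ρ ((Quotient.out x : Q) : G) v) :=
    ((ρ g).toAddMonoidHom : V →+ V).map_finsum (Set.toFinite _)
  rw [relTrace_apply ρ R Q hv Quotient.out hout, hmap,
    relTrace_apply ρ _ Q (rho_mem_fixedPoints_map hv g) Quotient.out hout']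
  refine finsum_eq_of_bijective (fun x => QuotientGroup.mk (c (Quotient.out x))) ⟨?_, ?_⟩ ?_
  · intro x y hxy
    rw [← hout x, ← hout y, QuotientGroup.eq, ← hc]
    exact QuotientGroup.eq.1 hxy
  · intro y
    let q : Q := Quotient.out y
    have hq : g⁻¹ * (q : G) * g ∈ Q := by
      rw [hgQ]
      simp [q, mul_assoc]
    refine ⟨QuotientGroup.mk ⟨g⁻¹ * q * g, hq⟩, ?_⟩
    have hcq : c ⟨g⁻¹ * q * g, hq⟩ = q := Subtype.ext (by simp [c, mul_assoc])
    refine Eq.trans ?_ (hout' y)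
    change QuotientGroup.mk (c _) = QuotientGroup.mk q
    refine Eq.trans ?_ (congrArg QuotientGroup.mk hcq)
    rw [QuotientGroup.eq, hc]
    exact QuotientGroup.eq.1 (hout _)
  · intro x
    rw [rho_eq_of_mk_eq (rho_mem_fixedPoints_map hv g) (hout' (QuotientGroup.mk (c (Quotient.out x))))]
    simp only [c, ← Module.End.mul_apply, ← map_mul]
    simp

theorem rho_mem_traceSubmodule [Finite G] {ρ : Representation k G V} {Q : Subgroup G} {g : G}
    (hg : g ∈ Subgroup.normalizer (Q : Set G)) {v : V} (hv : v ∈ traceSubmodule ρ Q) :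
    ρ g v ∈ traceSubmodule ρ Q := by
  suffices h : traceSubmodule ρ Q ≤ (traceSubmodule ρ Q).comap (ρ g) from h hv
  conv_lhs => rw [traceSubmodule]
  refine iSup₂_le fun R hR => ?_
  rintro _ ⟨x, hx, rfl⟩
  rw [Submodule.mem_comap, rho_relTrace hg hx]
  have hlt : R.map (MulAut.conj g).toMonoidHom < Q := by
    have h1 : Q.map (MulAut.conj g).toMonoidHom = Q :=
      Subgroup.mem_normalizer_iff_map_conj_eq.1 hg
    conv_rhs => rw [← h1]
    exact (Subgroup.map_lt_map_iff_of_injective (MulAut.conj g).injective).2 hR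
  exact Submodule.mem_iSup_of_mem _ (Submodule.mem_iSup_of_mem hlt
    (Submodule.mem_map_of_mem (rho_mem_fixedPoints_map hx g)))

/-- The action of `N_G(Q)` on `V^Q`. -/
def fixedPointsRep (ρ : Representation k G V) (Q : Subgroup G) :
    Representation k (Subgroup.normalizer (Q : Set G)) (fixedPoints ρ Q) :=
  Representation.subrepresentation (ρ.comp (Subgroup.normalizer (Q : Set G)).subtype)
    (fixedPoints ρ Q) fun g _ hv => rho_mem_fixedPoints g.2 hv

/-- The underlying space of the Brauer quotient `V(Q) = V^Q / ∑_{R < Q} Tr^Q_R (V^R)`. -/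
abbrev BrauerQuotient (ρ : Representation k G V) (Q : Subgroup G) : Type _ :=
  fixedPoints ρ Q ⧸ (traceSubmodule ρ Q).comap (fixedPoints ρ Q).subtype

/-- The Brauer quotient `V(Q)` as a module for `N_G(Q)`. -/
def brauerRep [Finite G] (ρ : Representation k G V) (Q : Subgroup G) :
    Representation k (Subgroup.normalizer (Q : Set G)) (BrauerQuotient ρ Q) :=
  Representation.quotient (fixedPointsRep ρ Q) _
    fun g _ hv => rho_mem_traceSubmodule g.2 hv

/-- The restriction of `V(Q)` from `N_G(Q)` to `C_G(Q)`. -/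
def brauerRepCentralizer [Finite G] (ρ : Representation k G V) (Q : Subgroup G) :
    Representation k (Subgroup.centralizer (Q : Set G)) (BrauerQuotient ρ Q) :=
  (brauerRep ρ Q).comp (Subgroup.inclusion (Subgroup.centralizer_le_normalizer (Q : Set G)))

/-- Brauer indecomposability: for each `p`-subgroup `Q ≤ G`, the restriction of `V(Q)` to `C_G(Q)`
is indecomposable or zero. -/
def IsBrauerIndecomposable [Finite G] (p : ℕ) (ρ : Representation k G V) : Prop :=
  ∀ Q : Subgroup G, IsPGroup p Q →
    IsIndecomposable (brauerRepCentralizer ρ Q) ∨ Subsingleton (BrauerQuotient ρ Q)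

end BrauerConstruction

section Blocks

/-- The principal block of `kG`, given by its block idempotent `e`: the primitive idempotent `e` of
the centre of `kG` that acts as the identity on the trivial module. -/
structure IsPrincipalBlockIdempotent {k : Type*} [Field k] {G : Type*} [Group G]
    (e : Subalgebra.center k (MonoidAlgebra k G)) : Prop where
  idempotent : IsIdempotentElem e
  ne_zero : e ≠ 0
  primitive : ∀ e₁ e₂ : Subalgebra.center k (MonoidAlgebra k G),
    IsIdempotentElem e₁ → IsIdempotentElem e₂ → e₁ * e₂ = 0 → e = e₁ + e₂ → e₁ = 0 ∨ e₂ = 0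
  acts_on_trivial : (Representation.trivial k G k).asAlgebraHom (e : MonoidAlgebra k G) = 1

variable {k : Type*} [Field k] {G H L : Type*} [Group G] [Group H] [Group L]
  {M : Type*} [AddCommGroup M] [Module k M] {N : Type*} [AddCommGroup N] [Module k N]

/-- The left `kG`-module structure `g m = (g, 1) • m` of a `(kG, kH)`-bimodule. -/
def leftRep (ρ : Representation k (G × H) M) : Representation k G M :=
  ρ.comp (MonoidHom.inl G H)

/-- The right `kH`-module structure `m h = (1, h⁻¹) • m` of a `(kG, kH)`-bimodule, as an algebra
homomorphism from `kH` to the opposite of the algebra of `k`-endomorphisms. -/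
def rightAct (ρ : Representation k (G × H) M) :
    MonoidAlgebra k H →ₐ[k] (Module.End k M)ᵐᵒᵖ :=
  MonoidAlgebra.lift k (Module.End k M)ᵐᵒᵖ H
    { toFun := fun h => MulOpposite.op (ρ (1, h⁻¹))
      map_one' := by
        rw [inv_one, show ((1 : G), (1 : H)) = 1 from rfl, map_one, MulOpposite.op_one]
      map_mul' := fun x y => by
        rw [← MulOpposite.op_mul, ← map_mul]; simp }

/-- The `(kG, kH)`-bimodule `M` is a `(kGe, kHf)`-bimodule: `e m = m = m f` for all `m`. -/
def IsBlockBimodule (e : Subalgebra.center k (MonoidAlgebra k G))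
    (f : Subalgebra.center k (MonoidAlgebra k H)) (ρ : Representation k (G × H) M) : Prop :=
  ∀ m : M, (leftRep ρ).asAlgebraHom (e : MonoidAlgebra k G) m = m ∧
    (rightAct ρ (f : MonoidAlgebra k H)).unop m = m

/-- The action of `H` on `M ⊗_k N` by `m ⊗ n ↦ m h⁻¹ ⊗ h n`; its coinvariants are
`M ⊗_{kH} N`. -/
def middleRep (ρ : Representation k (G × H) M) (σ : Representation k (H × L) N) :
    Representation k H (M ⊗[k] N) :=
  Representation.tprod (ρ.comp (MonoidHom.inr G H)) (σ.comp (MonoidHom.inl H L))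

/-- The `(kG, kL)`-bimodule `M ⊗_{kH} N`. -/
def bimoduleTensor (ρ : Representation k (G × H) M) (σ : Representation k (H × L) N) :
    Representation k (G × L) (Representation.Coinvariants (middleRep ρ σ)) where
  toFun x := Representation.Coinvariants.map (middleRep ρ σ) (middleRep ρ σ)
    ⟨TensorProduct.map (ρ (x.1, 1)) (σ (1, x.2)), fun h => by
      ext m n
      simp [middleRep, ← Module.End.mul_apply, ← map_mul]⟩
  map_one' := by
    ext m n
    simp [show ((1 : G), (1 : H)) = 1 from rfl, show ((1 : H), (1 : L)) = 1 from rfl]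
  map_mul' x y := by
    have h1 : ρ ((x * y).1, 1) = ρ (x.1, 1) * ρ (y.1, 1) := by simp [← map_mul]
    have h2 : σ (1, (x * y).2) = σ (1, x.2) * σ (1, y.2) := by simp [← map_mul]
    ext m n
    simp only [h1, h2]
    simp

/-- The `(kG, kG)`-bimodule `kG`, that is `(g, h) • a = g a h⁻¹`. -/
def regularBimodule (k : Type*) [Field k] (G : Type*) [Group G] :
    Representation k (G × G) (MonoidAlgebra k G) where
  toFun x := LinearMap.mulLeft k (MonoidAlgebra.of k G x.1) ∘ₗ
    LinearMap.mulRight k (MonoidAlgebra.of k G x.2⁻¹)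
  map_one' := by
    refine LinearMap.ext fun a => ?_
    simp [← MonoidAlgebra.one_def]
  map_mul' x y := by
    refine LinearMap.ext fun a => ?_
    simp only [LinearMap.comp_apply, LinearMap.mulLeft_apply, LinearMap.mulRight_apply,
      Module.End.mul_apply, Prod.fst_mul, Prod.snd_mul, mul_inv_rev, map_mul, mul_assoc]

/-- The block algebra `kGe` as a `(kG, kG)`-bimodule. -/
def blockBimodule (e : Subalgebra.center k (MonoidAlgebra k G)) :
    Representation k (G × G)
      (LinearMap.range (LinearMap.mulRight k (e : MonoidAlgebra k G))) :=
  Representation.subrepresentation (regularBimodule k G) _ fun x => by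
    rintro _ ⟨a, rfl⟩
    refine ⟨regularBimodule k G x a, ?_⟩
    have he := Subalgebra.mem_center_iff.1 e.2
    have he' : ∀ b c : MonoidAlgebra k G, b * ((e : MonoidAlgebra k G) * c) =
        (e : MonoidAlgebra k G) * (b * c) := fun b c => by rw [← mul_assoc, he b, mul_assoc]
    simp [regularBimodule, mul_assoc, he, he']

end Blocks

section Morita

variable {k : Type u} [Field k] {G : Type v₁} {H : Type v₂} [Group G] [Group H]
  {M : Type w} [AddCommGroup M] [Module k M]

/-- The bimodule `M` induces a Morita equivalence between `A = kGe` and `B = kHf`: it is an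
`(A, B)`-bimodule and there is a (finitely generated) `(B, A)`-bimodule `N` with `M ⊗_B N ≅ A` and
`N ⊗_A M ≅ B` as bimodules.  As `e` and `f` act as identities, tensor products over `A` and over
`B` are tensor products over `kG` and over `kH`. -/
def InducesMoritaEquivalence (e : Subalgebra.center k (MonoidAlgebra k G))
    (f : Subalgebra.center k (MonoidAlgebra k H)) (ρ : Representation k (G × H) M) : Prop :=
  IsBlockBimodule e f ρ ∧
  ∃ (N : Type u) (_ : AddCommGroup N) (_ : Module k N) (_ : FiniteDimensional k N)
    (σ : Representation k (H × G) N),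
    IsBlockBimodule f e σ ∧
    Nonempty ((bimoduleTensor ρ σ).Equiv (blockBimodule e)) ∧
    Nonempty ((bimoduleTensor σ ρ).Equiv (blockBimodule f))

/-- `B₀(kG)` and `B₀(kH)` are splendidly Morita equivalent via `M`: `M` induces a Morita
equivalence between the principal blocks and is a `p`-permutation module for `G × H`. -/
def InducesSplendidMoritaEquivalencePrincipal (p : ℕ) (ρ : Representation k (G × H) M) : Prop :=
  (∃ (e : Subalgebra.center k (MonoidAlgebra k G)) (f : Subalgebra.center k (MonoidAlgebra k H)),
    IsPrincipalBlockIdempotent e ∧ IsPrincipalBlockIdempotent f ∧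
    InducesMoritaEquivalence e f ρ) ∧
  IsPPermutation p ρ

end Morita

section Groups

variable {G H P : Type*} [Group G] [Group H] [Group P]

/-- `i` identifies `P` with a Sylow `p`-subgroup of `G`. -/
def IsSylowEmbedding (p : ℕ) (i : P →* G) : Prop :=
  Function.Injective i ∧ ∃ S : Sylow p G, (S : Subgroup G) = i.range

/-- The diagonal subgroup `ΔP` of `G × H`, for a group `P` embedded in both `G` and `H`. -/
def diagonal (i : P →* G) (j : P →* H) : Subgroup (G × H) := (i.prod j).range

/-- `2.A₇`: the perfect central extension of `A₇` by a group of order 2. -/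
def IsDoubleCoverA7 (H : Type*) [Group H] : Prop :=
  ∃ π : H →* alternatingGroup (Fin 7),
    Function.Surjective π ∧ Nat.card π.ker = 2 ∧ π.ker ≤ Subgroup.center H ∧ commutator H = ⊤

/-- `2.PGL₂(F)`: the central extension of `PGL₂(F)` by a group of order 2 that has generalised
quaternion Sylow 2-subgroups (`QuaternionGroup (2 ^ m)` is `Q_{2^(m+2)}`). -/
def IsDoubleCoverPGL2 (F : Type*) [Field F] (H : Type*) [Group H] : Prop :=
  ∃ π : H →* Matrix.ProjGenLinGroup (Fin 2) F,
    Function.Surjective π ∧ Nat.card π.ker = 2 ∧ π.ker ≤ Subgroup.center H ∧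
    ∃ (m : ℕ) (S : Sylow 2 H), 1 ≤ m ∧ Nonempty (S ≃* QuaternionGroup (2 ^ m))

/-- The groups `Q_{2^n}` (`n ≥ 3`), `2.A₇`, `SL₂(q)` and `2.PGL₂(q)`, for odd prime powers `q`, up
to isomorphism. -/
inductive IsQuaternionModelGroup (H : Type*) [Group H] : Prop
  | quaternion (m : ℕ) (hm : 1 ≤ m) (φ : H ≃* QuaternionGroup (2 ^ m))
  | doubleCoverA7 (h : IsDoubleCoverA7 H)
  | specialLinear (F : Type) [Field F] [Finite F] (hF : ringChar F ≠ 2)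
      (φ : H ≃* Matrix.SpecialLinearGroup (Fin 2) F)
  | doubleCoverPGL2 (F : Type) [Field F] [Finite F] (hF : ringChar F ≠ 2)
      (h : IsDoubleCoverPGL2 F H)

end Groups

end

end BlockTheory

/-!
Let `f` be the principal block idempotent of `kH`, let `M` be the given bimodule, and let `Q` be a
`p`-subgroup of `G × H` with projections `Q₁ ≤ G` and `Q₂ ≤ H`.  The module `M` is a direct summand
of `k_{ΔP}↑^{G × H}`, and both `G` and `H` act freely on the cosets of `ΔP`.  Only this property of
the Scott module matters.  The coordinates on `M` coming from this permutation module
(`PermCoords`) give coordinates on `M(Q)` indexed by the `Q`-fixed points, and show that `M(Q)` is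
projective over `kC_G(Q₁)` and over `kC_H(Q₂)`.

By the Morita equivalence `kHf`, acting on the right, is the algebra of `kG`-endomorphisms of `M`
(`exists_asAlgebraHom_eq`, `mul_eq_zero_of_annihilates`).  By freeness, every
`kC_G(Q₁)`-endomorphism of `M(Q)` lifts to a `kG`-endomorphism of `M` that commutes with `Q`
(`exists_endomorphism_lift`); this comes from an element of `kH` fixed by `Q₂`, which acts on `M(Q)`
as its image in `kC_H(Q₂)` under the Brauer map (`brauerMk_rightRep`).  So
`kC_H(Q₂) → End_{kC_G(Q₁)}(M(Q))` is surjective.  As the target is projective over `kC_H(Q₂)` and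
group algebras are symmetric, the surjection splits off a direct factor of `kC_H(Q₂)`, and bimodule
endomorphisms of `M(Q)` lift multiplicatively to the centre of `kC_H(Q₂)`
(`exists_central_lift`).

A decomposition of `M(Q)` therefore yields two orthogonal central idempotents of `kC_H(Q₂)` below
`Br_{Q₂}(f)`.  At least one of them acts as zero on the trivial module, and by Brauer's third main
theorem (`IsNonprincipalBelow.eq_zero`) that one is zero.  The third main theorem is proved by
descending induction on the `p`-subgroup: the largest central idempotent below `Br_Q(f)` that kills
the trivial module is fixed by `N_G(Q)`, is annihilated by the Brauer maps of the larger `p`-subgroups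
of `N_G(Q)`, and so lifts to the centre of `kG`; Fitting's lemma there produces a central idempotent
of `kG` that is below `f` and kills the trivial module, hence is zero.
Elements of `kH` act through `m ↦ m h⁻¹`, so `f` appears as its image under inversion, `invMap k H f`.

The statement about quaternion defect groups is the case `p = 2`.
-/

namespace BlockTheory

open scoped TensorProduct

/-! ### Sums over finite sets with a group action -/

section OrbitSums

variable {Q α A : Type*} [Group Q] [MulAction Q α] [Fintype α] [AddCommGroup A]

open Classical in
theorem sum_mem_of_orbit_sums_mem (S : AddSubgroup A) (F : α → A)
    (h : ∀ x : α, ∑ y with y ∈ MulAction.orbit Q x, F y ∈ S) : ∑ x, F x ∈ S := by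
  rw [← Finset.sum_fiberwise Finset.univ (fun x => (Quotient.mk (MulAction.orbitRel Q α) x)) F]
  refine sum_mem fun j _ => ?_
  induction j using Quotient.inductionOn with
  | h x =>
    convert h x using 4 with y
    rw [Quotient.eq]
    rfl

open Classical in
/-- It suffices to test nontrivial orbits once the fixed points are left out. -/
theorem sum_ite_fixed_mem (S : AddSubgroup A) (F : α → A)
    (h : ∀ x : α, x ∉ MulAction.fixedPoints Q α →
      ∑ y with y ∈ MulAction.orbit Q x, F y ∈ S) :
    (∑ x, if x ∈ MulAction.fixedPoints Q α then 0 else F x) ∈ S := by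
  refine sum_mem_of_orbit_sums_mem (Q := Q) S _ fun x => ?_
  by_cases hx : x ∈ MulAction.fixedPoints Q α
  · rw [Finset.sum_eq_zero]
    · exact S.zero_mem
    · intro y hy
      obtain ⟨q, rfl⟩ := (Finset.mem_filter.1 hy).2
      simp only [hx q, hx, if_true]
  · convert h x hx using 1
    refine Finset.sum_congr rfl fun y hy => if_neg fun hy' => hx ?_
    obtain ⟨q, rfl⟩ := (Finset.mem_filter.1 hy).2
    have h1 : x = q • x := by simpa using hy' q⁻¹
    intro r
    rw [h1]
    exact hy' r

open Classical in
/-- In characteristic `p`, an invariant function on a finite set acted on by a `p`-group has the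
same sum over all points as over the fixed points. -/
theorem sum_eq_sum_fixed {p : ℕ} [Fact p.Prime] {k : Type*} [Field k] [CharP k p]
    (hQ : IsPGroup p Q) (f : α → k) (hf : ∀ (q : Q) x, f (q • x) = f x) :
    ∑ x, f x = ∑ x, if x ∈ MulAction.fixedPoints Q α then f x else 0 := by
  have h := sum_ite_fixed_mem (Q := Q) (⊥ : AddSubgroup k) f fun x hx => by
    rw [AddSubgroup.mem_bot, Finset.sum_congr rfl (g := fun _ => f x), Finset.sum_const,
      nsmul_eq_mul]
    · rw [← Fintype.card_subtype]
      have hc : p ∣ Fintype.card (MulAction.orbit Q x) := by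
        obtain ⟨n, hn⟩ := hQ.card_orbit x
        rw [Nat.card_eq_fintype_card] at hn
        rw [hn]
        refine dvd_pow_self p fun h0 => hx ?_
        rw [h0, pow_zero] at hn
        exact MulAction.mem_fixedPoints_iff_card_orbit_eq_one.2 (by convert hn)
      rw [show ((Fintype.card { y // y ∈ MulAction.orbit Q x } : ℕ) : k) = 0 from
        (CharP.cast_eq_zero_iff k p _).2 (by convert hc), zero_mul]
    · intro y hy
      obtain ⟨q, rfl⟩ := (Finset.mem_filter.1 hy).2
      exact hf q x
  rw [AddSubgroup.mem_bot] at h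
  rw [← sub_eq_zero, ← Finset.sum_sub_distrib]
  refine Eq.trans (Finset.sum_congr rfl fun x _ => ?_) h
  by_cases hx : x ∈ MulAction.fixedPoints Q α <;> simp [hx]

end OrbitSums

/-! ### The Brauer homomorphism of a group algebra -/

section BrauerHom

variable {k : Type*} [Field k] {G : Type*} [Group G]

open Classical in
/-- The Brauer map `kG → kC_G(Q)`, `∑ a_g g ↦ ∑_{g ∈ C_G(Q)} a_g g`, with values viewed inside
`kG`. -/
noncomputable def brauerMap (Q : Subgroup G) (a : MonoidAlgebra k G) : MonoidAlgebra k G :=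
  .ofCoeff (a.coeff.filter (· ∈ Subgroup.centralizer (Q : Set G)))

open Classical in
theorem coeff_brauerMap (Q : Subgroup G) (a : MonoidAlgebra k G) (x : G) :
    (brauerMap Q a).coeff x =
      if x ∈ Subgroup.centralizer (Q : Set G) then a.coeff x else 0 := by
  simp [brauerMap, Finsupp.filter_apply]

/-- `a` is fixed under conjugation by the elements of `S`. -/
def ConjInvariant (S : Set G) (a : MonoidAlgebra k G) : Prop :=
  ∀ g ∈ S, ∀ x, a.coeff (g * x * g⁻¹) = a.coeff x

theorem ConjInvariant.mono {S T : Set G} (h : S ⊆ T) {a : MonoidAlgebra k G}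
    (ha : ConjInvariant T a) : ConjInvariant S a := fun g hg => ha g (h hg)

theorem conjInvariant_iff {S : Set G} {a : MonoidAlgebra k G} :
    ConjInvariant S a ↔ ∀ g ∈ S, MonoidAlgebra.of k G g * a = a * MonoidAlgebra.of k G g := by
  refine forall₂_congr fun g _ => ⟨fun h => ?_, fun h x => ?_⟩
  · ext x
    have := h (g⁻¹ * x)
    simp only [MonoidAlgebra.of_apply, MonoidAlgebra.coeff_single_mul_apply,
      MonoidAlgebra.coeff_mul_single_apply, one_mul, mul_one]
    rw [← this]
    simp
  · have := congrArg (fun b : MonoidAlgebra k G => b.coeff (g * x)) h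
    simp only [MonoidAlgebra.of_apply, MonoidAlgebra.coeff_single_mul_apply,
      MonoidAlgebra.coeff_mul_single_apply, one_mul, mul_one] at this
    simpa using this.symm

theorem ConjInvariant.mul {S : Set G} {a b : MonoidAlgebra k G} (ha : ConjInvariant S a)
    (hb : ConjInvariant S b) : ConjInvariant S (a * b) := by
  rw [conjInvariant_iff] at *
  intro g hg
  rw [← mul_assoc, ha g hg, mul_assoc, hb g hg, mul_assoc]

theorem ConjInvariant.add {S : Set G} {a b : MonoidAlgebra k G} (ha : ConjInvariant S a)
    (hb : ConjInvariant S b) : ConjInvariant S (a + b) := fun g hg x => by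
  simp [ha g hg x, hb g hg x]

theorem ConjInvariant.sub {S : Set G} {a b : MonoidAlgebra k G} (ha : ConjInvariant S a)
    (hb : ConjInvariant S b) : ConjInvariant S (a - b) := by
  rw [conjInvariant_iff] at *
  intro g hg
  rw [mul_sub, sub_mul, ha g hg, hb g hg]

theorem conjInvariant_univ_iff {a : MonoidAlgebra k G} :
    ConjInvariant Set.univ a ↔ ∀ b, b * a = a * b := by
  rw [conjInvariant_iff]
  refine ⟨fun h b => ?_, fun h g _ => h _⟩
  induction b using MonoidAlgebra.induction_on with
  | of g => exact h g trivial
  | add x y hx hy => rw [add_mul, mul_add, hx, hy]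
  | smul r x hx => rw [smul_mul_assoc, mul_smul_comm, hx]

/-- An element supported on the subgroup `C` commutes with everything fixed by `C`. -/
theorem ConjInvariant.commute_of_support {C : Subgroup G} {a b : MonoidAlgebra k G}
    (ha : ConjInvariant (C : Set G) a) (hb : ∀ x, x ∉ C → b.coeff x = 0) : b * a = a * b := by
  rw [conjInvariant_iff] at ha
  have : b = b.coeff.sum fun g r => r • MonoidAlgebra.of k G g := by
    conv_lhs => rw [← MonoidAlgebra.sum_coeff_single b]
    simp [Finsupp.sum, MonoidAlgebra.of_apply]
  rw [this, Finsupp.sum, Finset.sum_mul, Finset.mul_sum]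
  refine Finset.sum_congr rfl fun g hg => ?_
  have hgC : g ∈ C := by
    by_contra h
    exact (Finsupp.mem_support_iff.1 hg) (hb g h)
  rw [smul_mul_assoc, mul_smul_comm, ha g hgC]

theorem conj_mem_centralizer_iff {Q : Subgroup G} {g : G}
    (hg : g ∈ Subgroup.normalizer (Q : Set G)) (x : G) :
    g * x * g⁻¹ ∈ Subgroup.centralizer (Q : Set G) ↔ x ∈ Subgroup.centralizer (Q : Set G) := by
  have hgQ := Subgroup.mem_normalizer_iff.1 hg
  simp only [Subgroup.mem_centralizer_iff, SetLike.mem_coe]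
  constructor
  · intro h q hq
    have := h _ ((hgQ q).1 hq)
    rw [conj_mul, conj_mul] at this
    exact (mul_right_injective g) ((mul_left_injective g⁻¹) this)
  · intro h q hq
    obtain ⟨r, rfl⟩ : ∃ r, q = g * r * g⁻¹ := ⟨g⁻¹ * q * g, by group⟩
    have := h r ((hgQ r).2 hq)
    simp only [mul_assoc, inv_mul_cancel_left]
    rw [← mul_assoc r, this, mul_assoc]

/-- Conjugation by elements of the normalizer of `Q` commutes with the Brauer map. -/
theorem ConjInvariant.brauerMap {S : Set G} {Q : Subgroup G} {a : MonoidAlgebra k G}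
    (hS : S ⊆ Subgroup.normalizer (Q : Set G)) (ha : ConjInvariant S a) :
    ConjInvariant S (brauerMap Q a) := by
  intro g hg x
  rw [coeff_brauerMap, coeff_brauerMap]
  have := conj_mem_centralizer_iff (hS hg) x
  by_cases hx : x ∈ Subgroup.centralizer (Q : Set G)
  · rw [if_pos hx, if_pos (this.2 hx), ha g hg x]
  · rw [if_neg hx, if_neg fun h => hx (this.1 h)]

theorem brauerMap_brauerMap {Q R : Subgroup G} (h : Q ≤ R) (a : MonoidAlgebra k G) :
    brauerMap R (brauerMap Q a) = brauerMap R a := by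
  ext x
  simp only [coeff_brauerMap]
  split_ifs with h1 h2
  · rfl
  · exact absurd (Subgroup.centralizer_le h h1) h2
  · rfl

theorem coeff_brauerMap_of_notMem {Q : Subgroup G} {a : MonoidAlgebra k G} {x : G}
    (hx : x ∉ Subgroup.centralizer (Q : Set G)) : (brauerMap Q a).coeff x = 0 := by
  rw [coeff_brauerMap, if_neg hx]

open Classical in
/-- In characteristic `p`, the sum of a function fixed under conjugation by a `p`-subgroup is its
sum over the centralizer. -/
theorem sum_eq_sum_centralizer {p : ℕ} [Fact p.Prime] [CharP k p] [Fintype G] {Q : Subgroup G}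
    (hQ : IsPGroup p Q) (f : G → k) (hf : ∀ q ∈ Q, ∀ x, f (q * x * q⁻¹) = f x) :
    ∑ x, f x = ∑ x, if x ∈ Subgroup.centralizer (Q : Set G) then f x else 0 := by
  let Q' : Subgroup (ConjAct G) := Q.map ConjAct.toConjAct.toMonoidHom
  have hQ' : IsPGroup p Q' := hQ.map _
  rw [sum_eq_sum_fixed (Q := Q') hQ' f]
  · refine Finset.sum_congr rfl fun x _ => ?_
    congr 1
    simp only [MulAction.mem_fixedPoints, Subtype.forall, Subgroup.mem_centralizer_iff, eq_iff_iff]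
    constructor
    · intro h q hq
      have := h (ConjAct.toConjAct q) ⟨q, hq, rfl⟩
      change ConjAct.toConjAct q • x = x at this
      rw [ConjAct.toConjAct_smul] at this
      exact mul_inv_eq_iff_eq_mul.1 this
    · rintro h _ ⟨q, hq, rfl⟩
      change ConjAct.toConjAct q • x = x
      rw [ConjAct.toConjAct_smul]
      exact mul_inv_eq_iff_eq_mul.2 (h q hq)
  · rintro ⟨_, q, hq, rfl⟩ x
    change f (ConjAct.toConjAct q • x) = f x
    rw [ConjAct.toConjAct_smul]
    exact hf q hq x

theorem coeff_mul_eq_sum [Fintype G] (a b : MonoidAlgebra k G) (x : G) :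
    (a * b).coeff x = ∑ g, a.coeff g * b.coeff (g⁻¹ * x) := by
  rw [MonoidAlgebra.coeff_mul_apply_left, Finsupp.sum_fintype]
  simp

variable {p : ℕ} [Fact p.Prime] [CharP k p] [Finite G]

/-- The Brauer map is multiplicative on the elements fixed by the `p`-subgroup `Q`. -/
theorem brauerMap_mul {Q : Subgroup G} (hQ : IsPGroup p Q) {a b : MonoidAlgebra k G}
    (ha : ConjInvariant (Q : Set G) a) (hb : ConjInvariant (Q : Set G) b) :
    brauerMap Q (a * b) = brauerMap Q a * brauerMap Q b := by
  classical
  have := Fintype.ofFinite G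
  ext x
  rw [coeff_brauerMap, coeff_mul_eq_sum, coeff_mul_eq_sum]
  simp only [coeff_brauerMap]
  split_ifs with hx
  · rw [sum_eq_sum_centralizer hQ]
    · refine Finset.sum_congr rfl fun g _ => ?_
      by_cases hg : g ∈ Subgroup.centralizer (Q : Set G)
      · have : g⁻¹ * x ∈ Subgroup.centralizer (Q : Set G) := mul_mem (inv_mem hg) hx
        simp [hg, this]
      · simp [hg]
    · intro q hq g
      have h1 : (q * g * q⁻¹)⁻¹ * x = q * (g⁻¹ * x) * q⁻¹ := by
        have := Subgroup.mem_centralizer_iff.1 hx q hq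
        have h2 : q⁻¹ * x = x * q⁻¹ := by
          rw [inv_mul_eq_iff_eq_mul, ← mul_assoc, this, mul_inv_cancel_right]
        simp only [mul_inv_rev, inv_inv, mul_assoc, h2]
      rw [ha q hq, h1, hb q hq]
  · symm
    refine Finset.sum_eq_zero fun g _ => ?_
    by_cases hg : g ∈ Subgroup.centralizer (Q : Set G)
    · have : g⁻¹ * x ∉ Subgroup.centralizer (Q : Set G) := fun h =>
        hx (by simpa using mul_mem hg h)
      simp [this]
    · simp [hg]

variable (k G) in
/-- The augmentation map `kG → k`. -/
noncomputable def augmentation : MonoidAlgebra k G →ₐ[k] k := MonoidAlgebra.lift k k G 1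

omit [Finite G] in
theorem augmentation_eq_sum [Fintype G] (a : MonoidAlgebra k G) :
    augmentation k G a = ∑ g, a.coeff g := by
  rw [augmentation, MonoidAlgebra.lift_apply, Finsupp.sum_fintype] <;> simp

theorem augmentation_brauerMap {Q : Subgroup G} (hQ : IsPGroup p Q) {a : MonoidAlgebra k G}
    (ha : ConjInvariant (Q : Set G) a) :
    augmentation k G (brauerMap Q a) = augmentation k G a := by
  classical
  have := Fintype.ofFinite G
  rw [augmentation_eq_sum, augmentation_eq_sum, sum_eq_sum_centralizer hQ _ ha]
  simp only [coeff_brauerMap]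

end BrauerHom

/-! ### Brauer's third main theorem -/

section ThirdMain

variable {k : Type*} [Field k] {G : Type*} [Group G]

/-- The condition, for a central idempotent `b` of `kG`, that `t` is an idempotent of the centre of
`kC_G(Q)` that lies under `Br_Q(b)` and acts as zero on the trivial module. -/
structure IsNonprincipalBelow (b : MonoidAlgebra k G) (Q : Subgroup G) (t : MonoidAlgebra k G) :
    Prop where
  support : ∀ x, x ∉ Subgroup.centralizer (Q : Set G) → t.coeff x = 0
  invariant : ConjInvariant (Subgroup.centralizer (Q : Set G) : Set G) t
  idem : t * t = t
  below : t * brauerMap Q b = t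
  aug : augmentation k G t = 0

theorem IsNonprincipalBelow.commute {b t u : MonoidAlgebra k G} {Q : Subgroup G}
    (ht : IsNonprincipalBelow b Q t) (hu : IsNonprincipalBelow b Q u) : t * u = u * t :=
  hu.invariant.commute_of_support ht.support

theorem IsNonprincipalBelow.sup {b t u : MonoidAlgebra k G} {Q : Subgroup G}
    (ht : IsNonprincipalBelow b Q t) (hu : IsNonprincipalBelow b Q u) :
    IsNonprincipalBelow b Q (t + u - t * u) where
  support x hx := by
    have h1 : (t * u).coeff x = 0 := by
      classical
      rw [MonoidAlgebra.coeff_mul_apply_left]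
      refine Finset.sum_eq_zero fun g hg => ?_
      have hgC : g ∈ Subgroup.centralizer (Q : Set G) := by
        by_contra h
        exact (Finsupp.mem_support_iff.1 hg) (ht.support g h)
      have hu0 : u.coeff (g⁻¹ * x) = 0 :=
        hu.support _ fun h => hx (by simpa using mul_mem hgC h)
      simp only [hu0, mul_zero]
    simp [h1, ht.support x hx, hu.support x hx]
  invariant := (ht.invariant.add hu.invariant).sub (ht.invariant.mul hu.invariant)
  idem := by
    have hc := ht.commute hu
    have h1 : (t * u) * (t * u) = t * u := by
      rw [mul_assoc, ← mul_assoc u, ← hc, mul_assoc t u u, hu.idem, ← mul_assoc, ht.idem]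
    have h2 : t * (t * u) = t * u := by rw [← mul_assoc, ht.idem]
    have h3 : t * u * u = t * u := by rw [mul_assoc, hu.idem]
    have h4 : t * u * t = t * u := by rw [mul_assoc, ← hc, h2]
    have h5 : u * (t * u) = t * u := by rw [← mul_assoc, ← hc, h3]
    simp only [mul_sub, sub_mul, mul_add, add_mul, ht.idem, hu.idem, h1, h2, h3, h4, h5, ← hc]
    abel
  below := by rw [sub_mul, add_mul, mul_assoc, ht.below, hu.below]
  aug := by simp [ht.aug, hu.aug]

/-- There is a greatest idempotent among those considered. -/
theorem exists_greatest_nonprincipalBelow [Finite G] (b : MonoidAlgebra k G) (Q : Subgroup G) :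
    ∃ t, IsNonprincipalBelow b Q t ∧ ∀ u, IsNonprincipalBelow b Q u → t * u = u := by
  let r : MonoidAlgebra k G → ℕ := fun t => Module.finrank k (LinearMap.range (LinearMap.mulLeft k t))
  have : FiniteDimensional k (MonoidAlgebra k G) :=
    Module.Finite.equiv (MonoidAlgebra.coeffLinearEquiv k : MonoidAlgebra k G ≃ₗ[k] (G →₀ k)).symm
  let S : Set ℕ := r '' {t | IsNonprincipalBelow b Q t}
  have hne : S.Nonempty := by
    refine ⟨_, 0, ⟨fun x _ => by simp, fun g _ x => by simp, by simp, by simp, by simp⟩, rfl⟩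
  have hbdd : BddAbove S := by
    refine ⟨Module.finrank k (MonoidAlgebra k G), ?_⟩
    rintro _ ⟨t, -, rfl⟩
    exact Submodule.finrank_le _
  obtain ⟨t, ht, htr⟩ := Nat.sSup_mem hne hbdd
  refine ⟨t, ht, fun u hu => ?_⟩
  have hj := IsNonprincipalBelow.sup ht hu
  have hc := IsNonprincipalBelow.commute ht hu
  have hjt : (t + u - t * u) * t = t := by
    rw [sub_mul, add_mul, IsNonprincipalBelow.idem ht, mul_assoc, ← hc, ← mul_assoc,
      IsNonprincipalBelow.idem ht]
    abel
  have hle : LinearMap.range (LinearMap.mulLeft k t) ≤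
      LinearMap.range (LinearMap.mulLeft k (t + u - t * u)) := by
    rintro _ ⟨a, rfl⟩
    refine ⟨t * a, ?_⟩
    simp only [LinearMap.mulLeft_apply]
    rw [← mul_assoc, hjt]
  have heq := Submodule.eq_of_le_of_finrank_le hle
    ((le_csSup hbdd ⟨_, hj, rfl⟩).trans_eq htr.symm)
  obtain ⟨a, ha⟩ : t + u - t * u ∈ LinearMap.range (LinearMap.mulLeft k t) := by
    rw [heq]
    exact ⟨1, by simp⟩
  simp only [LinearMap.mulLeft_apply] at ha
  have h1 : t * (t + u - t * u) = t + u - t * u := by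
    rw [← ha, ← mul_assoc, IsNonprincipalBelow.idem ht]
  rw [mul_sub, mul_add, ← mul_assoc, IsNonprincipalBelow.idem ht] at h1
  have h2 : t = t + (u - t * u) := by
    rw [add_sub_cancel_right] at h1
    rw [← add_sub_assoc]
    exact h1
  exact (sub_eq_zero.1 (left_eq_add.1 h2)).symm

theorem coeff_conj (n : G) (t : MonoidAlgebra k G) (x : G) :
    (MonoidAlgebra.of k G n * t * MonoidAlgebra.of k G n⁻¹).coeff x = t.coeff (n⁻¹ * x * n) := by
  simp [MonoidAlgebra.of_apply, MonoidAlgebra.coeff_single_mul_apply,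
    MonoidAlgebra.coeff_mul_single_apply, mul_assoc]

theorem of_conj_mul (n : G) (t u : MonoidAlgebra k G) :
    MonoidAlgebra.of k G n * (t * u) * MonoidAlgebra.of k G n⁻¹ =
      (MonoidAlgebra.of k G n * t * MonoidAlgebra.of k G n⁻¹) *
        (MonoidAlgebra.of k G n * u * MonoidAlgebra.of k G n⁻¹) := by
  have : MonoidAlgebra.of k G n⁻¹ * MonoidAlgebra.of k G n = 1 := by
    rw [← map_mul, inv_mul_cancel, map_one]
  simp only [mul_assoc]
  rw [← mul_assoc (MonoidAlgebra.of k G n⁻¹) (MonoidAlgebra.of k G n), this, one_mul]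

theorem of_conj_eq_self {n : G} {t : MonoidAlgebra k G} {S : Set G} (ht : ConjInvariant S t)
    (hn : n ∈ S) : MonoidAlgebra.of k G n * t * MonoidAlgebra.of k G n⁻¹ = t := by
  rw [conjInvariant_iff.1 ht n hn, mul_assoc, ← map_mul, mul_inv_cancel, map_one, mul_one]

theorem IsNonprincipalBelow.conj {b t : MonoidAlgebra k G} (hb : ConjInvariant Set.univ b)
    {Q : Subgroup G} (ht : IsNonprincipalBelow b Q t) {n : G}
    (hn : n ∈ Subgroup.normalizer (Q : Set G)) :
    IsNonprincipalBelow b Q (MonoidAlgebra.of k G n * t * MonoidAlgebra.of k G n⁻¹) where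
  support x hx := by
    rw [coeff_conj, ht.support]
    intro h
    have := (conj_mem_centralizer_iff hn _).2 h
    exact hx (by simpa [mul_assoc] using this)
  invariant c hc x := by
    rw [coeff_conj, coeff_conj]
    have hc' : n⁻¹ * c * n ∈ Subgroup.centralizer (Q : Set G) := by
      rw [← conj_mem_centralizer_iff hn]
      simpa [mul_assoc] using hc
    refine Eq.trans ?_ (ht.invariant _ hc' (n⁻¹ * x * n))
    congr 1
    simp [mul_assoc]
  idem := by rw [← of_conj_mul, ht.idem]
  below := by
    have h1 : ConjInvariant (Subgroup.normalizer (Q : Set G) : Set G) (brauerMap Q b) :=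
      (hb.mono (Set.subset_univ _)).brauerMap subset_rfl
    conv_lhs => rw [← of_conj_eq_self h1 hn]
    rw [← of_conj_mul, ht.below]
  aug := by simp [ht.aug]

theorem IsNonprincipalBelow.conj_eq_of_greatest {b t : MonoidAlgebra k G}
    (hb : ConjInvariant Set.univ b) {Q : Subgroup G} (ht : IsNonprincipalBelow b Q t)
    (hmax : ∀ u, IsNonprincipalBelow b Q u → t * u = u) :
    ConjInvariant (Subgroup.normalizer (Q : Set G) : Set G) t := by
  rw [conjInvariant_iff]
  intro n hn
  set N := MonoidAlgebra.of k G n with hN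
  set N' := MonoidAlgebra.of k G n⁻¹ with hN'
  have hNN' : N * N' = 1 := by rw [hN, hN', ← map_mul, mul_inv_cancel, map_one]
  have hN'N : N' * N = 1 := by rw [hN, hN', ← map_mul, inv_mul_cancel, map_one]
  have h0 := ht.conj hb hn
  have h1 := hmax _ h0
  have h2 := hmax _ (ht.conj hb (inv_mem hn))
  rw [inv_inv, ← hN, ← hN'] at h2
  rw [← hN, ← hN'] at h0 h1
  have h3 : (N * t * N') * t = t := by
    calc (N * t * N') * t = N * (t * (N' * t * N)) * N' := by
          simp only [mul_assoc, hNN', mul_one]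
      _ = N * (N' * t * N) * N' := by rw [h2]
      _ = t := by
        rw [mul_assoc, mul_assoc, hNN', mul_one, ← mul_assoc, hNN', one_mul]
  have h4 : N * t * N' = t := by
    rw [← h1, ht.commute h0, h3]
  calc N * t = N * t * N' * N := by rw [mul_assoc _ N', hN'N, mul_one]
    _ = t * N := by rw [h4]

end ThirdMain

section Sylow

variable {p : ℕ} [Fact p.Prime] {G : Type*} [Group G] [Finite G]

/-- A `p`-subgroup `Q` of `C` that is not a Sylow subgroup of `C` is normal in a strictly larger
`p`-subgroup of `C`. -/
theorem exists_lt_le_normalizer {Q C : Subgroup G} (hQ : IsPGroup p Q) (hQC : Q ≤ C)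
    (h : Nat.card Q ≠ p ^ (Nat.card C).factorization p) :
    ∃ R : Subgroup G, Q < R ∧ R ≤ C ∧ R ≤ Subgroup.normalizer (Q : Set G) ∧ IsPGroup p R := by
  have hp : p.Prime := Fact.out
  obtain ⟨n, hn⟩ := IsPGroup.iff_card.1 hQ
  have hdvd : p ^ n ∣ Nat.card C := hn ▸ Subgroup.card_dvd_of_le hQC
  have hle : n ≤ (Nat.card C).factorization p :=
    (hp.pow_dvd_iff_le_factorization Nat.card_pos.ne').1 hdvd
  have hlt : n < (Nat.card C).factorization p :=
    lt_of_le_of_ne hle fun h' => h (by rw [hn, h'])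
  have hdvd' : p ^ (n + 1) ∣ Nat.card C :=
    (hp.pow_dvd_iff_le_factorization Nat.card_pos.ne').2 hlt
  have hcard : Nat.card (Q.subgroupOf C) = p ^ n := by
    rw [← hn]
    exact Nat.card_congr (Subgroup.subgroupOfEquivOfLe hQC).toEquiv
  obtain ⟨K, hK, hQK⟩ := Sylow.exists_subgroup_card_pow_succ hdvd' hcard
  have hR : Nat.card (K.map C.subtype) = p ^ (n + 1) := by
    rw [Subgroup.card_map_of_injective C.subtype_injective, hK]
  have hle' : Q ≤ K.map C.subtype := by
    intro q hq
    exact ⟨⟨q, hQC hq⟩, hQK (Subgroup.mem_subgroupOf.2 hq), rfl⟩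
  have hne : Q ≠ K.map C.subtype := fun h' => by
    rw [← h', hn] at hR
    exact absurd (Nat.pow_right_injective hp.two_le hR) (by simp)
  refine ⟨K.map C.subtype, lt_of_le_of_ne hle' hne, Subgroup.map_subtype_le K, ?_,
    IsPGroup.of_card hR⟩
  rw [← Subgroup.normal_subgroupOf_iff_le_normalizer hle']
  refine Subgroup.normal_of_index_eq_minFac_card ?_
  rw [hR, hp.pow_minFac (Nat.succ_ne_zero n)]
  have h1 := (Q.subgroupOf (K.map C.subtype)).card_mul_index
  rw [Nat.card_congr (Subgroup.subgroupOfEquivOfLe hle').toEquiv, hn, hR, pow_succ] at h1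
  exact Nat.eq_of_mul_eq_mul_left (pow_pos hp.pos n) h1

omit [Finite G] in
theorem centralizer_conj (g x : G) : Subgroup.centralizer ({g * x * g⁻¹} : Set G) =
    (Subgroup.centralizer ({x} : Set G)).map (MulAut.conj g).toMonoidHom := by
  ext y
  simp only [Subgroup.mem_centralizer_singleton_iff, Subgroup.mem_map]
  constructor
  · intro h
    refine ⟨g⁻¹ * y * g, ?_, by simp [mul_assoc]⟩
    have h2 : g⁻¹ * (y * (g * x * g⁻¹)) * g = g⁻¹ * ((g * x * g⁻¹) * y) * g := by rw [h]
    simpa [mul_assoc] using h2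
  · rintro ⟨c, hc, rfl⟩
    simp only [MulEquiv.coe_toMonoidHom, MulAut.conj_apply, conj_mul, hc]

/-- If `Q` is a Sylow subgroup of the centralizers of `x` and of a conjugate `y` of `x`, then `x`
and `y` are conjugate under the normalizer of `Q`. -/
theorem exists_mem_normalizer_conj_eq {Q : Subgroup G} {x g : G}
    (hx : Q ≤ Subgroup.centralizer ({x} : Set G))
    (hx' : Nat.card Q = p ^ (Nat.card (Subgroup.centralizer ({x} : Set G))).factorization p)
    (hy : Q ≤ Subgroup.centralizer ({g * x * g⁻¹} : Set G)) :
    ∃ n ∈ Subgroup.normalizer (Q : Set G), n * x * n⁻¹ = g * x * g⁻¹ := by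
  set C := Subgroup.centralizer ({g * x * g⁻¹} : Set G) with hC
  have hcardC : Nat.card C = Nat.card (Subgroup.centralizer ({x} : Set G)) := by
    rw [hC, centralizer_conj, Subgroup.card_map_of_injective (MulAut.conj g).injective]
  have hgQ : Q.map (MulAut.conj g).toMonoidHom ≤ C := by
    rw [hC, centralizer_conj]
    exact Subgroup.map_mono hx
  have hcard : Nat.card (Q.subgroupOf C) = p ^ (Nat.card C).factorization p := by
    rw [hcardC, ← hx']
    exact Nat.card_congr (Subgroup.subgroupOfEquivOfLe hy).toEquiv
  have hcard' : Nat.card ((Q.map (MulAut.conj g).toMonoidHom).subgroupOf C) =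
      p ^ (Nat.card C).factorization p := by
    rw [hcardC, ← hx', Nat.card_congr (Subgroup.subgroupOfEquivOfLe hgQ).toEquiv,
      Subgroup.card_map_of_injective (MulAut.conj g).injective]
  obtain ⟨c, hc⟩ := MulAction.exists_smul_eq C (Sylow.ofCard _ hcard) (Sylow.ofCard _ hcard')
  have hmem : ∀ y : C, (y : G) ∈ Q ↔ (c : G) * y * (c : G)⁻¹ ∈ Q.map (MulAut.conj g).toMonoidHom := by
    intro y
    have h1 : c * y * c⁻¹ ∈ (c • Sylow.ofCard _ hcard : Sylow p C) ↔ y ∈ Sylow.ofCard _ hcard :=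
      Subgroup.smul_mem_pointwise_smul_iff (a := MulAut.conj c)
    rw [hc] at h1
    exact h1.symm
  refine ⟨(c : G)⁻¹ * g, ?_, ?_⟩
  · rw [Subgroup.mem_normalizer_iff]
    have key : ∀ q : G, g * q * g⁻¹ ∈ Q.map (MulAut.conj g).toMonoidHom ↔ q ∈ Q := fun q =>
      Subgroup.mem_map_iff_mem (f := (MulAut.conj g).toMonoidHom) (MulAut.conj g).injective
    have heq : ∀ q : G, (c : G) * ((c : G)⁻¹ * g * q * ((c : G)⁻¹ * g)⁻¹) * (c : G)⁻¹ =
        g * q * g⁻¹ := fun q => by simp [mul_assoc]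
    intro q
    constructor
    · intro hq
      have h1 := (key q).2 hq
      have h2 : (c : G)⁻¹ * g * q * ((c : G)⁻¹ * g)⁻¹ ∈ C := by
        have := mul_mem (mul_mem (inv_mem c.2) (hgQ h1)) c.2
        simpa [mul_assoc] using this
      exact (hmem ⟨_, h2⟩).2 ((heq q).symm ▸ h1)
    · intro hq
      exact (key q).1 (heq q ▸ (hmem ⟨_, hy hq⟩).1 hq)
  · have h1 := Subgroup.mem_centralizer_singleton_iff.1 c.2
    have : (c : G)⁻¹ * (g * x * g⁻¹) * c = g * x * g⁻¹ := by
      rw [mul_assoc, ← h1, inv_mul_cancel_left]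
    simpa [mul_assoc] using this


variable {k : Type*} [Field k]

/-- A function on `C_G(Q)` that is invariant under `N_G(Q)` and supported on the elements `x` for
which `Q` is a Sylow subgroup of `C_G(x)` extends to a class function on `G`. -/
theorem exists_central_brauerMap_eq {Q : Subgroup G} {t : MonoidAlgebra k G}
    (ht : ConjInvariant (Subgroup.normalizer (Q : Set G) : Set G) t)
    (hsupp : ∀ x, t.coeff x ≠ 0 → Q ≤ Subgroup.centralizer ({x} : Set G) ∧
      Nat.card Q = p ^ (Nat.card (Subgroup.centralizer ({x} : Set G))).factorization p) :
    ∃ z : MonoidAlgebra k G, ConjInvariant Set.univ z ∧ brauerMap Q z = t := by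
  classical
  let D : G → Prop := fun x => Q ≤ Subgroup.centralizer ({x} : Set G) ∧
    Nat.card Q = p ^ (Nat.card (Subgroup.centralizer ({x} : Set G))).factorization p
  let f : G → k := fun y => if h : ∃ x, D x ∧ ∃ g, g * x * g⁻¹ = y then t.coeff h.choose else 0
  have hle : ∀ x : G, x ∈ Subgroup.centralizer (Q : Set G) ↔
      Q ≤ Subgroup.centralizer ({x} : Set G) := by
    intro x
    rw [Subgroup.mem_centralizer_iff, SetLike.le_def]
    simp only [Subgroup.mem_centralizer_singleton_iff, SetLike.mem_coe]
  have hinv : ∀ x x' g, D x → D x' → g * x * g⁻¹ = x' → t.coeff x = t.coeff x' := by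
    rintro x _ g hx hx' rfl
    obtain ⟨n, hn, hnx⟩ := exists_mem_normalizer_conj_eq hx.1 hx.2 hx'.1
    rw [← hnx, ht n hn]
  have hconj : ∀ a b c : G, a * b * a⁻¹ = c → b = a⁻¹ * c * a := by
    rintro a b _ rfl
    simp [mul_assoc]
  have hf : ∀ x g, D x → f (g * x * g⁻¹) = t.coeff x := by
    intro x g hx
    have h : ∃ x', D x' ∧ ∃ g', g' * x' * g'⁻¹ = g * x * g⁻¹ := ⟨x, hx, g, rfl⟩
    obtain ⟨g', hg'⟩ := h.choose_spec.2
    have h1 := hinv x h.choose (g'⁻¹ * g) hx h.choose_spec.1 (by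
      calc g'⁻¹ * g * x * (g'⁻¹ * g)⁻¹ = g'⁻¹ * (g * x * g⁻¹) * g' := by simp [mul_assoc]
        _ = h.choose := (hconj _ _ _ hg').symm)
    rw [h1]
    exact dif_pos h
  have hf0 : ∀ y, (¬ ∃ x, D x ∧ ∃ g, g * x * g⁻¹ = y) → f y = 0 := fun y h => dif_neg h
  refine ⟨.ofCoeff (Finsupp.equivFunOnFinite.symm f), ?_, ?_⟩
  · intro g _ y
    change f (g * y * g⁻¹) = f y
    by_cases h : ∃ x, D x ∧ ∃ g, g * x * g⁻¹ = y
    · obtain ⟨x, hx, c, rfl⟩ := h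
      rw [hf x c hx, ← hf x (g * c) hx]
      simp [mul_assoc]
    · rw [hf0 y h, hf0]
      rintro ⟨x, hx, c, hc⟩
      refine h ⟨x, hx, g⁻¹ * c, ?_⟩
      calc g⁻¹ * c * x * (g⁻¹ * c)⁻¹ = g⁻¹ * (c * x * c⁻¹) * g := by simp [mul_assoc]
        _ = y := by rw [hc]; simp [mul_assoc]
  · ext y
    rw [coeff_brauerMap]
    change (if _ then f y else 0) = _
    split_ifs with hy
    · by_cases h : ∃ x, D x ∧ ∃ g, g * x * g⁻¹ = y
      · obtain ⟨x, hx, g, rfl⟩ := h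
        rw [hf x g hx]
        refine hinv _ _ g hx ⟨(hle _).1 hy, ?_⟩ rfl
        rw [centralizer_conj, Subgroup.card_map_of_injective (MulAut.conj g).injective]
        exact hx.2
      · rw [hf0 y h]
        by_contra hne
        exact h ⟨y, hsupp y (Ne.symm hne), 1, by simp⟩
    · by_contra hne
      exact hy ((hle y).2 (hsupp y (Ne.symm hne)).1)

theorem brauerMap_pow {Q : Subgroup G} [CharP k p] (hQ : IsPGroup p Q) {a : MonoidAlgebra k G}
    (ha : ConjInvariant (Q : Set G) a) (n : ℕ) :
    ConjInvariant (Q : Set G) (a ^ (n + 1)) ∧ brauerMap Q (a ^ (n + 1)) = brauerMap Q a ^ (n + 1) := by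
  induction n with
  | zero => simpa using ha
  | succ n ih =>
    rw [pow_succ _ (n + 1), pow_succ _ (n + 1)]
    exact ⟨ih.1.mul ha, by rw [brauerMap_mul hQ ih.1 ha, ih.2]⟩

/-- **Brauer's third main theorem**: if `b` is the principal block idempotent of `kG` and `Q` is a
`p`-subgroup, then `Br_Q(b)` has no nonzero central idempotent below it that acts as zero on the
trivial module, so that it is the principal block idempotent of `kC_G(Q)`. -/
theorem IsNonprincipalBelow.eq_zero [CharP k p] {b : MonoidAlgebra k G}
    (hb : ConjInvariant Set.univ b) (hb2 : b * b = b)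
    (hprim : ∀ E : MonoidAlgebra k G, ConjInvariant Set.univ E → E * E = E → E * b = E →
      E = 0 ∨ E = b)
    (hε : augmentation k G b = 1) {Q : Subgroup G} (hQ : IsPGroup p Q) :
    ∀ {t : MonoidAlgebra k G}, IsNonprincipalBelow b Q t → t = 0 := by
  induction Q using WellFoundedGT.induction with
  | ind Q ih =>
  obtain ⟨t, ht, hmax⟩ := exists_greatest_nonprincipalBelow b Q
  have hN := ht.conj_eq_of_greatest hb hmax
  suffices h0 : t = 0 by
    intro u hu
    rw [← hmax u hu, h0, zero_mul]
  have hQN : (Q : Set G) ⊆ Subgroup.normalizer (Q : Set G) := Subgroup.le_normalizer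
  have hbQ : ∀ R : Subgroup G, ConjInvariant (R : Set G) b := fun R => hb.mono (Set.subset_univ _)
  -- By induction, `t` vanishes on the centralizers of the `p`-groups in which `Q` is normal.
  have hvan : ∀ R : Subgroup G, Q < R → R ≤ Subgroup.normalizer (Q : Set G) → IsPGroup p R →
      brauerMap R t = 0 := by
    intro R hQR hRN hR
    have htR : ConjInvariant (R : Set G) t := hN.mono hRN
    refine ih R hQR hR ⟨fun x hx => coeff_brauerMap_of_notMem hx, ?_, ?_, ?_, ?_⟩
    · refine ConjInvariant.brauerMap ?_ (ht.invariant.mono ?_)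
      · exact Subgroup.centralizer_le_normalizer (R : Set G)
      · exact Subgroup.centralizer_le hQR.le
    · rw [← brauerMap_mul hR htR htR, ht.idem]
    · rw [← brauerMap_brauerMap hQR.le b, ← brauerMap_mul hR htR, ht.below]
      exact (hbQ R).brauerMap hRN
    · rw [augmentation_brauerMap hR htR, ht.aug]
  obtain ⟨z, hz, hzt⟩ := exists_central_brauerMap_eq (p := p) hN (fun x hx => by
    have hxC : x ∈ Subgroup.centralizer (Q : Set G) := by
      by_contra h
      exact hx (ht.support x h)
    have hQx : Q ≤ Subgroup.centralizer ({x} : Set G) := fun q hq =>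
      Subgroup.mem_centralizer_singleton_iff.2 (Subgroup.mem_centralizer_iff.1 hxC q hq)
    refine ⟨hQx, ?_⟩
    by_contra hcard
    obtain ⟨R, hQR, hRC, hRN, hR⟩ := exists_lt_le_normalizer hQ hQx hcard
    have h1 := congrArg (fun a : MonoidAlgebra k G => a.coeff x) (hvan R hQR hRN hR)
    simp only [coeff_brauerMap] at h1
    rw [if_pos] at h1
    · exact hx (by simpa using h1)
    · exact Subgroup.mem_centralizer_iff.2 fun r hr =>
        Subgroup.mem_centralizer_singleton_iff.1 (hRC hr))
  -- The element `w = z b` of the local algebra `Z(kG) b` satisfies `Br_Q(w) = t`.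
  set w := z * b with hw
  have hwinv : ConjInvariant Set.univ w := hz.mul hb
  have hwQ : ConjInvariant (Q : Set G) w := hwinv.mono (Set.subset_univ _)
  have hwt : brauerMap Q w = t := by
    rw [hw, brauerMap_mul hQ (hz.mono (Set.subset_univ _)) (hbQ Q), hzt, ht.below]
  have hwε : augmentation k G w = 0 := by
    rw [← augmentation_brauerMap hQ hwQ, hwt, ht.aug]
  have hwb : w * b = w := by rw [hw, mul_assoc, hb2]
  have htpow : ∀ n : ℕ, t ^ (n + 1) = t := fun n => by
    induction n with
    | zero => simp
    | succ n ih => rw [pow_succ, ih, ht.idem]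
  -- Fitting's lemma in the centre of `kG`.
  let c : Subalgebra.center k (MonoidAlgebra k G) :=
    ⟨w, Subalgebra.mem_center_iff.2 (conjInvariant_univ_iff.1 hwinv)⟩
  have : FiniteDimensional k (MonoidAlgebra k G) :=
    Module.Finite.equiv (MonoidAlgebra.coeffLinearEquiv k : MonoidAlgebra k G ≃ₗ[k] (G →₀ k)).symm
  have : IsArtinianRing (Subalgebra.center k (MonoidAlgebra k G)) := IsArtinianRing.of_finite k _
  obtain ⟨n, y, hy⟩ := IsArtinian.exists_pow_succ_smul_dvd c
    (1 : Subalgebra.center k (MonoidAlgebra k G))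
  simp only [smul_eq_mul, mul_one] at hy
  let d : Subalgebra.center k (MonoidAlgebra k G) :=
    ⟨b, Subalgebra.mem_center_iff.2 (conjInvariant_univ_iff.1 hb)⟩
  have hcd : c * d = c := Subtype.ext hwb
  have hdd : d * d = d := Subtype.ext hb2
  have hpow : ∀ m, c ^ (n + 1) = c ^ (n + 1 + m) * y ^ m := by
    intro m
    induction m with
    | zero => simp
    | succ m ih =>
      calc c ^ (n + 1) = c ^ (m + 1) * c ^ n * y ^ m := by rw [ih]; ring
        _ = c ^ (m + 1) * (c ^ n.succ * y) * y ^ m := by rw [hy]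
        _ = c ^ (n + 1 + (m + 1)) * y ^ (m + 1) := by
          rw [Nat.succ_eq_add_one]; ring
  let E := c ^ (n + 1) * y ^ (n + 1) * d
  have hEE : E * E = E := by
    calc E * E = (c ^ (n + 1 + (n + 1)) * y ^ (n + 1)) * y ^ (n + 1) * (d * d) := by
          simp only [E]; ring
      _ = E := by rw [← hpow (n + 1), hdd]
  have hEd : E * d = E := by simp only [E]; rw [mul_assoc, hdd]
  rcases hprim E (conjInvariant_univ_iff.2 (Subalgebra.mem_center_iff.1 E.2))
    (congrArg Subtype.val hEE) (congrArg Subtype.val hEd) with h0 | h1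
  · have hE0 : E = 0 := Subtype.ext h0
    have h2 : c ^ (n + 1) = 0 := by
      calc c ^ (n + 1) = c ^ n * (c * d) := by rw [hcd, pow_succ]
        _ = c ^ (n + 1) * d := by ring
        _ = c ^ (n + 1 + (n + 1)) * y ^ (n + 1) * d := by rw [← hpow]
        _ = c ^ (n + 1) * E := by simp only [E]; ring
        _ = 0 := by rw [hE0, mul_zero]
    have h3 : w ^ (n + 1) = 0 := congrArg Subtype.val h2
    rw [← htpow n, ← hwt, ← (brauerMap_pow hQ hwQ n).2, h3]
    ext x
    rw [coeff_brauerMap]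
    simp
  · have h2 : augmentation k G (w ^ (n + 1) * (y ^ (n + 1) : MonoidAlgebra k G) * b) = 1 := by
      rw [← hε]
      exact congrArg _ h1
    simp [hwε] at h2

end Sylow

/-! ### Bimodules that are projective on both sides -/

section Bimodule

variable {k : Type*} [Field k] {C : Type*} [Group C]

theorem coeff_one_mul_comm (a b : MonoidAlgebra k C) :
    (a * b).coeff 1 = (b * a).coeff 1 := by
  induction a using MonoidAlgebra.induction_on with
  | of g =>
    simp only [MonoidAlgebra.of_apply, MonoidAlgebra.coeff_single_mul_apply,
      MonoidAlgebra.coeff_mul_single_apply]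
    simp
  | add x y hx hy => simp [add_mul, mul_add, hx, hy]
  | smul r x hx => simp [hx]

theorem eq_zero_of_coeff_one_mul {x : MonoidAlgebra k C}
    (h : ∀ b, (x * b).coeff 1 = 0) : x = 0 := by
  ext g
  have := h (MonoidAlgebra.of k C g⁻¹)
  simpa [MonoidAlgebra.of_apply, MonoidAlgebra.coeff_mul_single_apply] using this

/-- An idempotent `η` of a group algebra with `A (1 - η) A η = 0` is central, as the group algebra
is symmetric. -/
theorem commute_of_idempotent_of_forall {η : MonoidAlgebra k C}
    (h : ∀ b, b * η = η * b * η) (a : MonoidAlgebra k C) : η * a = a * η := by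
  rw [h a, ← sub_eq_zero]
  refine eq_zero_of_coeff_one_mul fun b => ?_
  have h1 : (η * a * η * b).coeff 1 = (η * (a * b)).coeff 1 := by
    rw [mul_assoc, mul_assoc, coeff_one_mul_comm, coeff_one_mul_comm η, mul_assoc, mul_assoc,
      mul_assoc, ← mul_assoc η b, ← h]
  rw [sub_mul, MonoidAlgebra.coeff_sub, Finsupp.sub_apply, h1, mul_assoc, sub_self]

variable {D : Type*} [Group D] [Fintype C] [Fintype D] {V : Type*} [AddCommGroup V] [Module k V]

/-- Let `V` be a `(kD, kC)`-bimodule that is projective on both sides, where projectivity is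
expressed through Higman's criterion by `κ` and `ν`.  If every `kD`-endomorphism of `V` comes from
`kC`, then the bimodule endomorphisms of `V` lift multiplicatively to the centre of `kC`.

The algebra `E` of `kD`-endomorphisms is projective as a `kC`-module, so `kC → E` splits; the
image `η` of `1` under a splitting is a central idempotent and `kC η ≅ E`. -/
theorem exists_central_lift (σ : Representation k D V) (τ : Representation k C V)
    (hcomm : ∀ d c, σ d * τ c = τ c * σ d) {κ ν : Module.End k V}
    (hκ : ∑ d, σ d * κ * σ d⁻¹ = 1) (hν : ∑ c, τ c * ν * τ c⁻¹ = 1)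
    (hsurj : ∀ θ : Module.End k V, (∀ d, σ d * θ = θ * σ d) → ∃ a, τ.asAlgebraHom a = θ) :
    ∃ s : Module.End k V →ₗ[k] MonoidAlgebra k C,
      (∀ θ, (∀ d, σ d * θ = θ * σ d) → τ.asAlgebraHom (s θ) = θ) ∧
      ∀ θ, (∀ d, σ d * θ = θ * σ d) → (∀ c, τ c * θ = θ * τ c) →
        (∀ a, a * s θ = s θ * a) ∧ (∀ ψ, s (θ * ψ) = s θ * s ψ) ∧
        (∀ x, τ.asAlgebraHom x = 1 → s θ * x = s θ) := by
  set A := τ.asAlgebraHom with hA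
  have hAof : ∀ c, A (MonoidAlgebra.of k C c) = τ c := fun c => by
    rw [hA, Representation.asAlgebraHom_of]
  obtain ⟨s₁, hs₁⟩ := A.toLinearMap.rangeRestrict.exists_rightInverse_of_surjective
    (LinearMap.range_rangeRestrict _)
  obtain ⟨s₀, hs₀⟩ := LinearMap.exists_extend s₁
  have hs₀A : ∀ θ, (∀ d, σ d * θ = θ * σ d) → A (s₀ θ) = θ := by
    intro θ hθ
    have hmem : θ ∈ LinearMap.range A.toLinearMap := hsurj θ hθ
    have h1 := LinearMap.congr_fun hs₀ ⟨θ, hmem⟩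
    have h2 := congrArg Subtype.val (LinearMap.congr_fun hs₁ ⟨θ, hmem⟩)
    simp only [LinearMap.comp_apply, Submodule.subtype_apply] at h1
    rw [h1]
    exact h2
  let μ : Module.End k V →ₗ[k] Module.End k V :=
    ∑ d, LinearMap.mulLeft k (σ d * ν) ∘ₗ LinearMap.mulRight k (κ * σ d⁻¹)
  have hμ : ∀ θ, μ θ = ∑ d, σ d * (ν * θ * κ) * σ d⁻¹ := fun θ => by
    simp [μ, LinearMap.sum_apply, mul_assoc]
  have hμcomm : ∀ θ d, σ d * μ θ = μ θ * σ d := by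
    intro θ d
    rw [hμ, Finset.mul_sum, Finset.sum_mul, ← Equiv.sum_comp (Equiv.mulLeft d)
      (fun x => σ x * (ν * θ * κ) * σ x⁻¹ * σ d)]
    refine Finset.sum_congr rfl fun x _ => ?_
    simp only [Equiv.coe_mulLeft, mul_assoc, ← map_mul, mul_inv_rev, inv_mul_cancel, mul_one]
    simp only [map_mul, mul_assoc]
  let s : Module.End k V →ₗ[k] MonoidAlgebra k C :=
    ∑ c, LinearMap.mulLeft k (MonoidAlgebra.of k C c) ∘ₗ s₀ ∘ₗ μ ∘ₗ LinearMap.mulLeft k (τ c⁻¹)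
  have hs : ∀ θ, s θ = ∑ c, MonoidAlgebra.of k C c * s₀ (μ (τ c⁻¹ * θ)) := fun θ => by
    simp [s, LinearMap.sum_apply]
  have hAs : ∀ θ, (∀ d, σ d * θ = θ * σ d) → A (s θ) = θ := by
    intro θ hθ
    have h1 : ∀ c, A (MonoidAlgebra.of k C c * s₀ (μ (τ c⁻¹ * θ))) =
        ∑ d, σ d * ((τ c * ν * τ c⁻¹) * θ * κ) * σ d⁻¹ := by
      intro c
      rw [map_mul, hAof, hs₀A _ (hμcomm _), hμ, Finset.mul_sum]
      refine Finset.sum_congr rfl fun d _ => ?_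
      simp only [mul_assoc]
      rw [← mul_assoc (τ c), ← hcomm, mul_assoc]
    rw [hs, map_sum, Finset.sum_congr rfl fun c _ => h1 c, Finset.sum_comm]
    have h2 : ∀ d, ∑ c, σ d * ((τ c * ν * τ c⁻¹) * θ * κ) * σ d⁻¹ =
        θ * (σ d * κ * σ d⁻¹) := by
      intro d
      rw [← Finset.sum_mul, ← Finset.mul_sum, ← Finset.sum_mul, ← Finset.sum_mul, hν, one_mul]
      simp only [← mul_assoc, hθ d]
    rw [Finset.sum_congr rfl fun d _ => h2 d, ← Finset.mul_sum, hκ, mul_one]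
  have hsof : ∀ c θ, s (τ c * θ) = MonoidAlgebra.of k C c * s θ := by
    intro c θ
    rw [hs, hs, Finset.mul_sum, ← Equiv.sum_comp (Equiv.mulLeft c)]
    refine Finset.sum_congr rfl fun x _ => ?_
    simp only [Equiv.coe_mulLeft, map_mul, mul_inv_rev, mul_assoc]
    rw [← mul_assoc (τ c⁻¹), ← map_mul τ, inv_mul_cancel, map_one, one_mul]
  have hsA : ∀ a θ, s (A a * θ) = a * s θ := by
    intro a θ
    induction a using MonoidAlgebra.induction_on with
    | of c => rw [hAof, hsof]
    | add x y hx hy => rw [map_add, add_mul, map_add, hx, hy, add_mul]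
    | smul r x hx => rw [map_smul, smul_mul_assoc, map_smul, hx, smul_mul_assoc]
  have hAη : A (s 1) = 1 := hAs 1 fun d => by rw [mul_one, one_mul]
  have hsa : ∀ a, s (A a) = a * s 1 := fun a => by rw [← hsA, mul_one]
  have hη : ∀ a, s 1 * a = a * s 1 := by
    refine commute_of_idempotent_of_forall fun b => ?_
    rw [← hsa b, ← hsa (s 1 * b), map_mul, hAη, one_mul]
  refine ⟨s, hAs, fun θ hθ hθ' => ?_⟩
  have hAt := hAs θ hθ
  have hθA : ∀ a, A a * θ = θ * A a := by
    intro a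
    induction a using MonoidAlgebra.induction_on with
    | of c => rw [hAof, hθ']
    | add x y hx hy => rw [map_add, add_mul, hx, hy, mul_add]
    | smul r x hx => rw [map_smul, smul_mul_assoc, hx, mul_smul_comm]
  have htη : s θ * s 1 = s θ := by rw [← hsa, hAt]
  have hta : ∀ a, s (θ * A a) = s θ * a := by
    intro a
    conv_lhs => rw [← hAt]
    rw [← map_mul, hsa, mul_assoc, ← hη, ← mul_assoc, htη]
  refine ⟨fun a => ?_, fun ψ => ?_, fun x hx => ?_⟩
  · rw [← hsA, hθA, hta]
  · conv_lhs => rw [← hAt]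
    exact hsA _ _
  · rw [← hta, hx, mul_one]

end Bimodule

/-! ### Inversion on a group algebra -/

section Inversion

variable {k : Type*} [Field k] {G : Type*} [Group G]

variable (k G) in
/-- The anti-automorphism of `kG` that inverts the elements of `G`. -/
noncomputable def invMap : MonoidAlgebra k G →ₗ[k] MonoidAlgebra k G :=
  MonoidAlgebra.mapDomainLinearMap k k fun x => x⁻¹

theorem invMap_of (g : G) : invMap k G (MonoidAlgebra.of k G g) = MonoidAlgebra.of k G g⁻¹ := by
  simp [invMap, MonoidAlgebra.of_apply]

theorem invMap_invMap (a : MonoidAlgebra k G) : invMap k G (invMap k G a) = a := by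
  induction a using MonoidAlgebra.induction_on with
  | of g => rw [invMap_of, invMap_of, inv_inv]
  | add x y hx hy => rw [map_add, map_add, hx, hy]
  | smul r x hx => rw [map_smul, map_smul, hx]

theorem invMap_mul (a b : MonoidAlgebra k G) :
    invMap k G (a * b) = invMap k G b * invMap k G a := by
  induction a using MonoidAlgebra.induction_on with
  | of g =>
    induction b using MonoidAlgebra.induction_on with
    | of h => rw [← map_mul, invMap_of, invMap_of, invMap_of, ← map_mul, mul_inv_rev]
    | add x y hx hy => rw [mul_add, map_add, hx, hy, map_add, add_mul]
    | smul r x hx => rw [mul_smul_comm, map_smul, hx, map_smul, smul_mul_assoc]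
  | add x y hx hy => rw [add_mul, map_add, hx, hy, map_add, mul_add]
  | smul r x hx => rw [smul_mul_assoc, map_smul, hx, map_smul, mul_smul_comm]

theorem augmentation_invMap (a : MonoidAlgebra k G) :
    augmentation k G (invMap k G a) = augmentation k G a := by
  induction a using MonoidAlgebra.induction_on with
  | of g => rw [invMap_of]; simp [augmentation]
  | add x y hx hy => rw [map_add, map_add, map_add, hx, hy]
  | smul r x hx => rw [map_smul, map_smul, map_smul, hx]

theorem ConjInvariant.invMap {a : MonoidAlgebra k G} (ha : ConjInvariant Set.univ a) :
    ConjInvariant Set.univ (invMap k G a) := by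
  rw [conjInvariant_univ_iff] at ha ⊢
  intro b
  rw [← invMap_invMap b, ← invMap_mul, ← invMap_mul, ha]

end Inversion

/-! ### Consequences of a Morita equivalence -/

section Morita

variable {k : Type*} [Field k] {G H L : Type*} [Group G] [Group H] [Group L]
  {M : Type*} [AddCommGroup M] [Module k M] {N : Type*} [AddCommGroup N] [Module k N]

/-- The restriction of a `(kG, kH)`-bimodule to `H`, that is `h • m = m h⁻¹`. -/
def rightRep (ρ : Representation k (G × H) M) : Representation k H M :=
  ρ.comp (MonoidHom.inr G H)

theorem rightAct_unop (ρ : Representation k (G × H) M) (a : MonoidAlgebra k H) :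
    (rightAct ρ a).unop = (rightRep ρ).asAlgebraHom (invMap k H a) := by
  induction a using MonoidAlgebra.induction_on with
  | of g =>
    rw [invMap_of, Representation.asAlgebraHom_of, rightAct, MonoidAlgebra.of_apply,
      MonoidAlgebra.lift_single]
    simp only [one_smul]
    rfl
  | add x y hx hy => rw [map_add, MulOpposite.unop_add, hx, hy, map_add, map_add]
  | smul r x hx => rw [map_smul, MulOpposite.unop_smul, hx, map_smul, map_smul]

theorem bimoduleTensor_mk (ρ : Representation k (G × H) M) (σ : Representation k (H × L) N)
    (x : G × L) (m : M) (n : N) :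
    bimoduleTensor ρ σ x (Representation.Coinvariants.mk (middleRep ρ σ) (m ⊗ₜ n)) =
      Representation.Coinvariants.mk (middleRep ρ σ) (ρ (x.1, 1) m ⊗ₜ σ (1, x.2) n) := rfl

theorem bimoduleTensor_right (ρ : Representation k (G × H) M) (σ : Representation k (H × L) N)
    (a : MonoidAlgebra k L) (m : M) (n : N) :
    (rightRep (bimoduleTensor ρ σ)).asAlgebraHom a
        (Representation.Coinvariants.mk (middleRep ρ σ) (m ⊗ₜ n)) =
      Representation.Coinvariants.mk (middleRep ρ σ)
        (m ⊗ₜ (rightRep σ).asAlgebraHom a n) := by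
  induction a using MonoidAlgebra.induction_on with
  | of g =>
    rw [Representation.asAlgebraHom_of, Representation.asAlgebraHom_of]
    simp only [rightRep, MonoidHom.comp_apply, MonoidHom.inr_apply, bimoduleTensor_mk]
    rw [show ((1 : G), (1 : H)) = 1 from rfl, map_one, Module.End.one_apply]
  | add x y hx hy =>
    rw [map_add, LinearMap.add_apply, hx, hy, map_add, LinearMap.add_apply, TensorProduct.tmul_add,
      map_add]
  | smul r x hx =>
    rw [map_smul, LinearMap.smul_apply, hx, map_smul, LinearMap.smul_apply, TensorProduct.tmul_smul,
      map_smul]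

theorem coe_blockBimodule (e : Subalgebra.center k (MonoidAlgebra k G)) (x : G × G)
    (v : LinearMap.range (LinearMap.mulRight k (e : MonoidAlgebra k G))) :
    (blockBimodule e x v : MonoidAlgebra k G) =
      MonoidAlgebra.of k G x.1 * v * MonoidAlgebra.of k G x.2⁻¹ := by
  change regularBimodule k G x v = _
  simp [regularBimodule, mul_assoc]

theorem coe_blockBimodule_left (e : Subalgebra.center k (MonoidAlgebra k G))
    (a : MonoidAlgebra k G)
    (v : LinearMap.range (LinearMap.mulRight k (e : MonoidAlgebra k G))) :
    ((leftRep (blockBimodule e)).asAlgebraHom a v : MonoidAlgebra k G) =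
      a * v := by
  induction a using MonoidAlgebra.induction_on with
  | of g =>
    rw [Representation.asAlgebraHom_of]
    simp only [leftRep, MonoidHom.comp_apply, MonoidHom.inl_apply, coe_blockBimodule, inv_one, map_one,
      mul_one]
  | add x y hx hy => rw [map_add, LinearMap.add_apply, Submodule.coe_add, hx, hy, add_mul]
  | smul r x hx => rw [map_smul, LinearMap.smul_apply, Submodule.coe_smul, hx, smul_mul_assoc]

theorem coe_blockBimodule_right (e : Subalgebra.center k (MonoidAlgebra k G))
    (a : MonoidAlgebra k G)
    (v : LinearMap.range (LinearMap.mulRight k (e : MonoidAlgebra k G))) :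
    ((rightRep (blockBimodule e)).asAlgebraHom a v : MonoidAlgebra k G) =
      v * invMap k G a := by
  induction a using MonoidAlgebra.induction_on with
  | of g =>
    rw [Representation.asAlgebraHom_of, invMap_of]
    simp only [rightRep, MonoidHom.comp_apply, MonoidHom.inr_apply, coe_blockBimodule, map_one, one_mul]
  | add x y hx hy =>
    rw [map_add, LinearMap.add_apply, Submodule.coe_add, hx, hy, map_add, mul_add]
  | smul r x hx =>
    rw [map_smul, LinearMap.smul_apply, Submodule.coe_smul, hx, map_smul, mul_smul_comm]

theorem equiv_asAlgebraHom {ρ : Representation k G M} {σ : Representation k G N}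
    (φ : ρ.Equiv σ) (a : MonoidAlgebra k G) (m : M) :
    φ (ρ.asAlgebraHom a m) = σ.asAlgebraHom a (φ m) := by
  induction a using MonoidAlgebra.induction_on with
  | of g =>
    rw [Representation.asAlgebraHom_of, Representation.asAlgebraHom_of]
    exact Representation.IntertwiningMap.isIntertwining _ _ φ.toIntertwiningMap g m
  | add x y hx hy =>
    rw [map_add, LinearMap.add_apply, map_add, hx, hy, map_add, LinearMap.add_apply]
  | smul r x hx =>
    rw [map_smul, LinearMap.smul_apply, map_smul, hx, map_smul, LinearMap.smul_apply]

theorem equiv_leftRep {ρ : Representation k (G × H) M} {σ : Representation k (G × H) N}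
    (φ : ρ.Equiv σ) (a : MonoidAlgebra k G) (m : M) :
    φ ((leftRep ρ).asAlgebraHom a m) = (leftRep σ).asAlgebraHom a (φ m) :=
  equiv_asAlgebraHom (ρ := leftRep ρ) (σ := leftRep σ)
    (.mk φ.toLinearEquiv fun g => φ.toIntertwiningMap.isIntertwining' (g, 1)) a m

theorem equiv_rightRep {ρ : Representation k (G × H) M} {σ : Representation k (G × H) N}
    (φ : ρ.Equiv σ) (a : MonoidAlgebra k H) (m : M) :
    φ ((rightRep ρ).asAlgebraHom a m) = (rightRep σ).asAlgebraHom a (φ m) :=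
  equiv_asAlgebraHom (ρ := rightRep ρ) (σ := rightRep σ)
    (.mk φ.toLinearEquiv fun h => φ.toIntertwiningMap.isIntertwining' (1, h)) a m

variable {ρ : Representation k (G × H) M} {σ : Representation k (H × G) N}
  {e : Subalgebra.center k (MonoidAlgebra k G)} {f : Subalgebra.center k (MonoidAlgebra k H)}

/-- As `N ⊗ M ≅ kHf`, an element of `kH` that annihilates `M` annihilates the block `kHf`. -/
theorem mul_eq_zero_of_annihilates
    (φ : (bimoduleTensor σ ρ).Equiv (blockBimodule f)) {z : MonoidAlgebra k H}
    (hz : (rightRep ρ).asAlgebraHom z = 0) :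
    z * invMap k H (f : MonoidAlgebra k H) = 0 := by
  have h0 : (rightRep (bimoduleTensor σ ρ)).asAlgebraHom z = 0 := by
    refine Representation.Coinvariants.hom_ext (TensorProduct.ext' fun n m => ?_)
    rw [LinearMap.comp_apply, bimoduleTensor_right, hz]
    simp
  let f' : LinearMap.range (LinearMap.mulRight k (f : MonoidAlgebra k H)) :=
    ⟨f, 1, by simp⟩
  have h1 := equiv_rightRep φ z (φ.symm f')
  rw [h0, LinearMap.zero_apply, map_zero] at h1
  have h2 : φ (φ.symm f') = f' := φ.toLinearEquiv.apply_symm_apply f'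
  rw [h2] at h1
  have h3 := congrArg Subtype.val h1
  rw [coe_blockBimodule_right] at h3
  have h4 := congrArg (invMap k H) h3
  rw [invMap_mul, invMap_invMap] at h4
  rw [← h4]
  simp

/-- As `M ⊗ N ≅ kGe` and `e` acts as the identity on `M`, tensoring with `N` is faithful on
endomorphisms of `M`. -/
theorem eq_zero_of_tensor_eq_zero (φ : (bimoduleTensor ρ σ).Equiv (blockBimodule e))
    (he : ∀ m, (leftRep ρ).asAlgebraHom (e : MonoidAlgebra k G) m = m)
    {θ : Module.End k M}
    (hθ : ∀ n m, Representation.Coinvariants.mk (middleRep σ ρ) (n ⊗ₜ[k] θ m) = 0) : θ = 0 := by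
  let B : M → N →ₗ[k] M →ₗ[k] M := fun m₀ =>
    (leftRep ρ).asAlgebraHom.toLinearMap ∘ₗ Submodule.subtype _ ∘ₗ φ.toLinearEquiv.toLinearMap ∘ₗ
      Representation.Coinvariants.mk (middleRep ρ σ) ∘ₗ TensorProduct.mk k M N m₀
  have hB : ∀ m₀ n, B m₀ n = (leftRep ρ).asAlgebraHom
      (φ (Representation.Coinvariants.mk (middleRep ρ σ) (m₀ ⊗ₜ n)) : MonoidAlgebra k G) :=
    fun _ _ => rfl
  have hB' : ∀ m₀ n g m, B m₀ (σ (1, g) n) (ρ (g, 1) m) = B m₀ n m := by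
    intro m₀ n g m
    have h1 : Representation.Coinvariants.mk (middleRep ρ σ) (m₀ ⊗ₜ σ (1, g) n) =
        bimoduleTensor ρ σ (1, g)
          (Representation.Coinvariants.mk (middleRep ρ σ) (m₀ ⊗ₜ n)) := by
      rw [bimoduleTensor_mk, show ((1 : G), (1 : H)) = 1 from rfl, map_one, Module.End.one_apply]
    have h2 : φ (bimoduleTensor ρ σ (1, g)
        (Representation.Coinvariants.mk (middleRep ρ σ) (m₀ ⊗ₜ n))) =
        blockBimodule e (1, g) (φ (Representation.Coinvariants.mk (middleRep ρ σ) (m₀ ⊗ₜ n))) :=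
      Representation.IntertwiningMap.isIntertwining _ _ φ.toIntertwiningMap _ _
    rw [hB, h1, h2, coe_blockBimodule, map_one, one_mul, map_mul, Representation.asAlgebraHom_of,
      Module.End.mul_apply, ← hB]
    congr 1
    change ρ (g⁻¹, 1) (ρ (g, 1) m) = m
    rw [← Module.End.mul_apply, ← map_mul]
    simp [show ((1 : G), (1 : H)) = 1 from rfl]
  have hzero : ∀ m₀ n m, B m₀ n (θ m) = 0 := by
    intro m₀ n m
    let F := Representation.Coinvariants.lift (middleRep σ ρ) (TensorProduct.lift (B m₀))
      (fun g => TensorProduct.ext' fun n m => hB' m₀ n g m)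
    have h1 : F (Representation.Coinvariants.mk (middleRep σ ρ) (n ⊗ₜ[k] θ m)) =
        B m₀ n (θ m) := rfl
    rw [← h1, hθ, map_zero]
  have hall : ∀ y m, (leftRep ρ).asAlgebraHom (φ y : MonoidAlgebra k G) (θ m) = 0 := by
    intro y m
    induction y using Representation.Coinvariants.induction_on with
    | _ y =>
      induction y using TensorProduct.induction_on with
      | zero => simp
      | tmul m₀ n => exact hzero m₀ n m
      | add x y hx hy =>
        rw [map_add, map_add, Submodule.coe_add, map_add, LinearMap.add_apply, hx, hy, add_zero]
  refine LinearMap.ext fun m => ?_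
  have h1 := hall (φ.symm ⟨e, 1, by simp⟩) m
  have h2 : φ (φ.symm ⟨e, 1, by simp⟩) = ⟨e, 1, by simp⟩ := φ.toLinearEquiv.apply_symm_apply _
  rw [h2, he] at h1
  exact h1

/-- Every `kG`-endomorphism of `M` comes from `kH`: tensoring with `N` turns it into a left
`kH`-endomorphism of `kHf`, which is a right multiplication. -/
theorem exists_asAlgebraHom_eq (hf : IsIdempotentElem f)
    (φ : (bimoduleTensor ρ σ).Equiv (blockBimodule e))
    (ψ : (bimoduleTensor σ ρ).Equiv (blockBimodule f))
    (he : ∀ m, (leftRep ρ).asAlgebraHom (e : MonoidAlgebra k G) m = m)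
    {θ : Module.End k M} (hθ : ∀ g, ρ (g, 1) * θ = θ * ρ (g, 1)) :
    ∃ z, (rightRep ρ).asAlgebraHom z = θ := by
  let Θ : Representation.Coinvariants (middleRep σ ρ) →ₗ[k]
      Representation.Coinvariants (middleRep σ ρ) :=
    Representation.Coinvariants.map (middleRep σ ρ) (middleRep σ ρ)
      ⟨θ.lTensor N, fun g => TensorProduct.ext' fun n m =>
        congrArg (σ (1, g) n ⊗ₜ[k] ·) (LinearMap.congr_fun (hθ g) m).symm⟩
  have hΘ : ∀ n m, Θ (Representation.Coinvariants.mk (middleRep σ ρ) (n ⊗ₜ m)) =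
      Representation.Coinvariants.mk (middleRep σ ρ) (n ⊗ₜ θ m) := fun _ _ => rfl
  have hΘH : ∀ h y, Θ (bimoduleTensor σ ρ (h, 1) y) = bimoduleTensor σ ρ (h, 1) (Θ y) := by
    intro h y
    suffices Θ ∘ₗ bimoduleTensor σ ρ (h, 1) = bimoduleTensor σ ρ (h, 1) ∘ₗ Θ from
      LinearMap.congr_fun this y
    refine Representation.Coinvariants.hom_ext (TensorProduct.ext' fun n m => ?_)
    simp only [LinearMap.comp_apply, bimoduleTensor_mk, hΘ]
    rw [show ((1 : G), (1 : H)) = 1 from rfl, map_one, Module.End.one_apply, Module.End.one_apply]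
  have hΘA : ∀ a y, Θ ((leftRep (bimoduleTensor σ ρ)).asAlgebraHom a y) =
      (leftRep (bimoduleTensor σ ρ)).asAlgebraHom a (Θ y) := by
    intro a y
    induction a using MonoidAlgebra.induction_on with
    | of h =>
      rw [Representation.asAlgebraHom_of]
      exact hΘH h y
    | add x y hx hy =>
      rw [map_add, LinearMap.add_apply, map_add, hx, hy, LinearMap.add_apply]
    | smul r x hx => rw [map_smul, LinearMap.smul_apply, map_smul, hx, LinearMap.smul_apply]
  let f' : LinearMap.range (LinearMap.mulRight k (f : MonoidAlgebra k H)) := ⟨f, 1, by simp⟩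
  have hψψ : ∀ y, ψ.symm (ψ y) = y := fun y => ψ.toLinearEquiv.symm_apply_apply y
  have hψψ' : ∀ y, ψ (ψ.symm y) = y := fun y => ψ.toLinearEquiv.apply_symm_apply y
  let w : MonoidAlgebra k H := ψ (Θ (ψ.symm f'))
  have hff : (f : MonoidAlgebra k H) * f = f := congrArg Subtype.val hf
  -- `Θ` corresponds to right multiplication by `w`.
  have hΘw : ∀ y, Θ y =
      (rightRep (bimoduleTensor σ ρ)).asAlgebraHom (invMap k H w) y := by
    intro y
    refine ψ.toLinearEquiv.injective (Subtype.ext ?_)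
    change (ψ (Θ y) : MonoidAlgebra k H) = ψ _
    rw [equiv_rightRep, coe_blockBimodule_right, invMap_invMap]
    have h1 : y = (leftRep (bimoduleTensor σ ρ)).asAlgebraHom
        (ψ y : MonoidAlgebra k H) (ψ.symm f') := by
      refine ψ.toLinearEquiv.injective (Subtype.ext ?_)
      change (ψ y : MonoidAlgebra k H) = ψ _
      rw [equiv_leftRep, coe_blockBimodule_left, hψψ']
      obtain ⟨b, hb⟩ := (ψ y).2
      rw [← hb]
      simp [f', mul_assoc, hff]
    conv_lhs => rw [h1]
    rw [hΘA, equiv_leftRep, coe_blockBimodule_left]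
  refine ⟨invMap k H w, ?_⟩
  refine (sub_eq_zero.1 (eq_zero_of_tensor_eq_zero φ he fun n m => ?_)).symm
  rw [LinearMap.sub_apply, TensorProduct.tmul_sub, map_sub, ← hΘ, hΘw, bimoduleTensor_right,
    sub_self]

end Morita

/-! ### Brauer quotients of direct summands of permutation modules -/

section Traces

variable {k : Type*} [Field k] {X : Type*} [Group X] [Finite X] {V : Type*} [AddCommGroup V]
  [Module k V]

open Classical in
/-- The sum of an equivariant family over the non-fixed points of a finite `Q`-set is a sum of
relative traces from proper subgroups. -/
theorem sum_ite_fixed_mem_traceSubmodule (ρ : Representation k X V) (Q : Subgroup X)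
    {α : Type*} [Fintype α] (φ : Q →* Equiv.Perm α) (F : α → V)
    (hF : ∀ (q : Q) a, ρ q (F a) = F (φ q a)) :
    (∑ a, if ∀ q, φ q a = a then 0 else F a) ∈ traceSubmodule ρ Q := by
  let : MulAction Q α := MulAction.compHom α φ
  have hsmul : ∀ (q : Q) (a : α), q • a = φ q a := fun _ _ => rfl
  have hfix : ∀ a : α, a ∈ MulAction.fixedPoints Q α ↔ ∀ q, φ q a = a := fun _ => Iff.rfl
  have h := sum_ite_fixed_mem (Q := Q) (traceSubmodule ρ Q).toAddSubgroup F fun a ha => by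
    let R : Subgroup X := (MulAction.stabilizer Q a).map Q.subtype
    have hRQ : R ≤ Q := Subgroup.map_subtype_le _
    have hmem : ∀ q : Q, (q : X) ∈ R ↔ q • a = a := fun q =>
      (Subgroup.mem_map_iff_mem Q.subtype_injective).trans MulAction.mem_stabilizer_iff
    have hlt : R < Q := by
      refine lt_of_le_of_ne hRQ fun h => ha fun q => ?_
      rw [← hmem, h]
      exact q.2
    have hfa : F a ∈ fixedPoints ρ R := by
      rw [mem_fixedPoints]
      intro r hr
      have := hF ⟨r, hRQ hr⟩ a
      rw [← hsmul, (hmem ⟨r, hRQ hr⟩).1 hr] at this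
      exact this
    have hout : ∀ x : Q ⧸ R.subgroupOf Q, QuotientGroup.mk (Quotient.out x) = x :=
      fun x => Quotient.out_eq' x
    have key : ∑ y with y ∈ MulAction.orbit Q a, F y = relTrace ρ R Q (F a) := by
      rw [relTrace_apply ρ R Q hfa Quotient.out hout]
      have : Fintype (Q ⧸ R.subgroupOf Q) := Fintype.ofFinite _
      rw [finsum_eq_sum_of_fintype]
      symm
      refine Finset.sum_bij (fun x _ => (Quotient.out x : Q) • a) ?_ ?_ ?_ ?_
      · intro x _
        exact Finset.mem_filter.2 ⟨Finset.mem_univ _, _, rfl⟩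
      · intro x _ y _ hxy
        rw [← hout x, ← hout y, QuotientGroup.eq, Subgroup.mem_subgroupOf, hmem, mul_smul,
          ← hxy, inv_smul_smul]
      · intro y hy
        obtain ⟨q, rfl⟩ := (Finset.mem_filter.1 hy).2
        refine ⟨QuotientGroup.mk q, Finset.mem_univ _, ?_⟩
        have h1 := hout (QuotientGroup.mk q)
        rw [QuotientGroup.eq, Subgroup.mem_subgroupOf, hmem, mul_smul, inv_smul_eq_iff] at h1
        exact h1.symm
      · intro x _
        exact hF _ _
    rw [key]
    exact Submodule.mem_iSup_of_mem R (Submodule.mem_iSup_of_mem hlt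
      (Submodule.mem_map_of_mem hfa))
  rw [Submodule.mem_toAddSubgroup] at h
  convert h using 4 with a
  exact (hfix a).symm

end Traces

section PermCoords

variable {k : Type*} [Field k] {C : Type*} [Group C] {V : Type*} [AddCommGroup V]
  [Module k V]

/-- A presentation of `V` as a direct summand of the permutation module on the finite set `Ω`
with action `φ`: the coordinate functions of the inclusion of `V` into `kΩ`, and the images in `V`
of the elements of `Ω`. -/
structure PermCoords (ρ : Representation k C V) {Ω : Type*} [Fintype Ω]
    (φ : C →* Equiv.Perm Ω) where
  /-- The coordinates of a vector under the inclusion `V → kΩ`. -/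
  coord : V →ₗ[k] Ω → k
  /-- The images of the elements of `Ω` under the projection `kΩ → V`. -/
  pt : Ω → V
  coord_apply : ∀ g v x, coord (ρ g v) (φ g x) = coord v x
  apply_pt : ∀ g x, ρ g (pt x) = pt (φ g x)
  sum_coord : ∀ v, ∑ x, coord v x • pt x = v

variable {ρ : Representation k C V} {Ω : Type*} [Fintype Ω] {φ : C →* Equiv.Perm Ω}

/-- Restriction along a group homomorphism. -/
def PermCoords.restrict (c : PermCoords ρ φ) {D : Type*} [Group D] (f : D →* C)
    {τ : Representation k D V} (hτ : ∀ d, τ d = ρ (f d)) : PermCoords τ (φ.comp f) where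
  coord := c.coord
  pt := c.pt
  coord_apply g v x := by rw [hτ]; exact c.coord_apply _ _ _
  apply_pt g x := by rw [hτ]; exact c.apply_pt _ _
  sum_coord := c.sum_coord

/-- Higman's criterion: a direct summand of a free module is projective. -/
theorem PermCoords.exists_sum_conj_eq_one [Fintype C] (c : PermCoords ρ φ)
    (hfree : ∀ g x, φ g x = x → g = 1) :
    ∃ ν : Module.End k V, ∑ g, ρ g * ν * ρ g⁻¹ = 1 := by
  classical
  let : MulAction C Ω := MulAction.compHom Ω φ
  have hsmul : ∀ (g : C) (x : Ω), g • x = φ g x := fun _ _ => rfl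
  let : Fintype (MulAction.orbitRel.Quotient C Ω) := Fintype.ofFinite _
  let r : MulAction.orbitRel.Quotient C Ω → Ω := Quotient.out
  let ν : Module.End k V := ∑ o, (LinearMap.proj (r o) ∘ₗ c.coord).smulRight (c.pt (r o))
  have hbij : Function.Bijective fun a : C × MulAction.orbitRel.Quotient C Ω => a.1 • r a.2 := by
    constructor
    · rintro ⟨g, o⟩ ⟨g', o'⟩ h
      simp only at h
      have ho : o = o' := by
        have h1 : (Quotient.mk _ (g • r o) : MulAction.orbitRel.Quotient C Ω) =
            Quotient.mk _ (g' • r o') := by rw [h]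
        have h2 : ∀ (g : C) o, (Quotient.mk _ (g • r o) : MulAction.orbitRel.Quotient C Ω) = o :=
          fun g o => by
            conv_rhs => rw [← Quotient.out_eq o]
            exact Quotient.sound ⟨g, rfl⟩
        rwa [h2, h2] at h1
      subst ho
      have h1 := hfree (g'⁻¹ * g) (r o) (by rw [← hsmul, mul_smul, h, inv_smul_smul])
      rw [inv_mul_eq_one] at h1
      rw [h1]
    · intro x
      have h1 : (Quotient.mk _ x : MulAction.orbitRel.Quotient C Ω) =
          Quotient.mk _ (r (Quotient.mk _ x)) := (Quotient.out_eq _).symm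
      obtain ⟨g, hg⟩ := Quotient.exact h1
      exact ⟨(g, Quotient.mk _ x), hg⟩
  refine ⟨ν, LinearMap.ext fun v => ?_⟩
  have hterm : ∀ g, (ρ g * ν * ρ g⁻¹) v = ∑ o, c.coord v (g • r o) • c.pt (g • r o) := by
    intro g
    simp only [Module.End.mul_apply, ν, LinearMap.sum_apply, LinearMap.smulRight_apply,
      LinearMap.comp_apply, LinearMap.proj_apply, map_sum, map_smul, c.apply_pt, hsmul]
    refine Finset.sum_congr rfl fun o _ => ?_
    have h1 := c.coord_apply g (ρ g⁻¹ v) (r o)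
    rw [← Module.End.mul_apply, ← map_mul, mul_inv_cancel, map_one, Module.End.one_apply] at h1
    rw [h1]
  rw [LinearMap.sum_apply, Finset.sum_congr rfl fun g _ => hterm g, ← Fintype.sum_prod_type',
    Module.End.one_apply]
  rw [hbij.sum_comp (fun x => c.coord v x • c.pt x)]
  exact c.sum_coord v

end PermCoords

section BrauerCoords

variable {k : Type*} [Field k] {X : Type*} [Group X] {V : Type*} [AddCommGroup V]
  [Module k V] {ρ : Representation k X V} {Ω : Type*} [Fintype Ω] {φ : X →* Equiv.Perm Ω}

/-- The class in `V(Q)` of a vector of `V^Q`. -/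
noncomputable def brauerMk (ρ : Representation k X V) (Q : Subgroup X) :
    fixedPoints ρ Q →ₗ[k] BrauerQuotient ρ Q :=
  Submodule.mkQ _

theorem brauerMk_surjective (Q : Subgroup X) : Function.Surjective (brauerMk ρ Q) :=
  Submodule.mkQ_surjective _

theorem brauerMk_eq_iff {Q : Subgroup X} {v w : fixedPoints ρ Q} :
    brauerMk ρ Q v = brauerMk ρ Q w ↔ (v - w : V) ∈ traceSubmodule ρ Q :=
  Submodule.Quotient.eq _

theorem apply_mem_fixedPoints {Q : Subgroup X} {x : X}
    (hx : x ∈ Subgroup.centralizer (Q : Set X)) {v : V} (hv : v ∈ fixedPoints ρ Q) :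
    ρ x v ∈ fixedPoints ρ Q :=
  rho_mem_fixedPoints (Subgroup.centralizer_le_normalizer _ hx) hv

theorem brauerRepCentralizer_mk [Finite X] {Q : Subgroup X} (x : Subgroup.centralizer (Q : Set X))
    (v : fixedPoints ρ Q) : brauerRepCentralizer ρ Q x (brauerMk ρ Q v) =
      brauerMk ρ Q ⟨ρ x v, apply_mem_fixedPoints x.2 v.2⟩ := rfl

namespace PermCoords

variable (c : PermCoords ρ φ) {Q : Subgroup X}

theorem pt_mem_fixedPoints {x : Ω} (hx : ∀ q : Q, φ q x = x) : c.pt x ∈ fixedPoints ρ Q :=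
  mem_fixedPoints.2 fun q hq => by rw [c.apply_pt, hx ⟨q, hq⟩]

theorem coord_of_mem_fixedPoints {v : V} (hv : v ∈ fixedPoints ρ Q) (q : Q) (x : Ω) :
    c.coord v (φ q x) = c.coord v x := by
  conv_lhs => rw [← mem_fixedPoints.1 hv q q.2]
  exact c.coord_apply _ _ _

open Classical in
/-- Modulo traces, replacing the vectors `pt x` by those of an arbitrary equivariant family `E`
only depends on the values of `E` at the fixed points. -/
theorem sum_sub_sum_fixed_mem_trace [Finite X] {v : V} (hv : v ∈ fixedPoints ρ Q) (E : Ω → V)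
    (hE : ∀ (q : Q) x, ρ q (E x) = E (φ q x)) :
    ∑ x, c.coord v x • E x - ∑ x, (if ∀ q : Q, φ q x = x then c.coord v x else 0) • E x ∈
      traceSubmodule ρ Q := by
  have h := sum_ite_fixed_mem_traceSubmodule ρ Q (φ.comp Q.subtype)
    (fun x => c.coord v x • E x) fun q x => by
      rw [map_smul, hE]
      exact congrArg (· • _) (c.coord_of_mem_fixedPoints hv q x).symm
  convert h using 1
  rw [← Finset.sum_sub_distrib]
  refine Finset.sum_congr rfl fun x _ => ?_
  by_cases hx : ∀ q : Q, φ q x = x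
  · rw [if_pos hx, sub_self, if_pos]
    exact hx
  · rw [if_neg hx, zero_smul, sub_zero, if_neg]
    exact hx

/-- Relative traces from proper subgroups have coordinate zero at the fixed points. -/
theorem coord_eq_zero_of_mem_trace [Finite X] {p : ℕ} [Fact p.Prime] [CharP k p] (hQ : IsPGroup p Q)
    {v : V} (hv : v ∈ traceSubmodule ρ Q) {x : Ω} (hx : ∀ q : Q, φ q x = x) :
    c.coord v x = 0 := by
  suffices h : traceSubmodule ρ Q ≤ LinearMap.ker (LinearMap.proj x ∘ₗ c.coord) from h hv
  refine iSup₂_le fun R hR => ?_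
  rintro _ ⟨w, hw, rfl⟩
  rw [LinearMap.mem_ker, LinearMap.comp_apply, LinearMap.proj_apply]
  have : Fintype (Q ⧸ R.subgroupOf Q) := Fintype.ofFinite _
  rw [relTrace_apply ρ R Q hw Quotient.out fun x => Quotient.out_eq' x,
    finsum_eq_sum_of_fintype, map_sum, Finset.sum_apply]
  have h1 : ∀ q : Q, c.coord (ρ q w) x = c.coord w x := by
    intro q
    conv_lhs => rw [← hx q]
    exact c.coord_apply _ _ _
  rw [Finset.sum_congr rfl fun q _ => h1 _, Finset.sum_const, Finset.card_univ, nsmul_eq_mul]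
  have h2 : p ∣ Fintype.card (Q ⧸ R.subgroupOf Q) := by
    obtain ⟨n, hn⟩ := hQ.index (R.subgroupOf Q)
    rw [Subgroup.index, Nat.card_eq_fintype_card] at hn
    rw [hn]
    refine dvd_pow_self p fun h0 => ?_
    rw [h0, pow_zero, ← Nat.card_eq_fintype_card] at hn
    have := Subgroup.index_eq_one.1 hn
    rw [Subgroup.subgroupOf_eq_top] at this
    exact absurd hR (not_lt_of_ge this)
  rw [(CharP.cast_eq_zero_iff k p _).2 h2, zero_mul]

omit [Fintype Ω] in
theorem map_mem_fixed_iff {Q : Subgroup X} (g : Subgroup.centralizer (Q : Set X)) (x : Ω) :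
    (∀ q : Q, φ q (φ g x) = φ g x) ↔ ∀ q : Q, φ q x = x := by
  refine forall_congr' fun q => ?_
  rw [← Equiv.Perm.mul_apply, ← map_mul, Subgroup.mem_centralizer_iff.1 g.2 q q.2, map_mul,
    Equiv.Perm.mul_apply, (φ g).injective.eq_iff]

open Classical in
/-- The coordinates of a vector of `V^Q` at the fixed points of `Q`, extended by zero. -/
noncomputable def fixedCoord (Q : Subgroup X) : fixedPoints ρ Q →ₗ[k] Ω → k :=
  LinearMap.pi fun x => if ∀ q : Q, φ q x = x
    then LinearMap.proj x ∘ₗ c.coord ∘ₗ (fixedPoints ρ Q).subtype else 0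

open Classical in
theorem fixedCoord_apply (v : fixedPoints ρ Q) (x : Ω) :
    c.fixedCoord Q v x = if ∀ q : Q, φ q x = x then c.coord v x else 0 := by
  rw [fixedCoord, LinearMap.pi_apply]
  split_ifs <;> rfl

variable [Finite X] {p : ℕ} [Fact p.Prime] [CharP k p]

/-- The coordinates on `V(Q)` induced by those at the fixed points of `Q`. -/
noncomputable def brauerCoord (hQ : IsPGroup p Q) : BrauerQuotient ρ Q →ₗ[k] Ω → k :=
  Submodule.liftQ _ (c.fixedCoord Q) fun v hv => by
    classical
    rw [LinearMap.mem_ker]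
    funext x
    rw [fixedCoord_apply]
    split_ifs with hx
    · exact c.coord_eq_zero_of_mem_trace hQ hv hx
    · rfl

open Classical in
theorem brauerCoord_mk (hQ : IsPGroup p Q) (v : fixedPoints ρ Q) (x : Ω) :
    c.brauerCoord hQ (brauerMk ρ Q v) x = if ∀ q : Q, φ q x = x then c.coord v x else 0 :=
  c.fixedCoord_apply v x

theorem brauerCoord_eq_zero (hQ : IsPGroup p Q) (w : BrauerQuotient ρ Q) {x : Ω}
    (hx : ¬ ∀ q : Q, φ q x = x) : c.brauerCoord hQ w x = 0 := by
  classical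
  obtain ⟨v, rfl⟩ := brauerMk_surjective Q w
  rw [brauerCoord_mk, if_neg hx]

/-- A linear section of `V^Q → V(Q)`, compatible with the action of the centralizer of `Q`. -/
noncomputable def brauerSection (hQ : IsPGroup p Q) : BrauerQuotient ρ Q →ₗ[k] V :=
  ∑ x, (LinearMap.proj x ∘ₗ c.brauerCoord hQ).smulRight (c.pt x)

theorem brauerSection_apply (hQ : IsPGroup p Q) (w : BrauerQuotient ρ Q) :
    c.brauerSection hQ w = ∑ x, c.brauerCoord hQ w x • c.pt x := by
  simp [brauerSection, LinearMap.sum_apply]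

theorem brauerSection_mem (hQ : IsPGroup p Q) (w : BrauerQuotient ρ Q) :
    c.brauerSection hQ w ∈ fixedPoints ρ Q := by
  rw [brauerSection_apply]
  refine sum_mem fun x _ => ?_
  by_cases hx : ∀ q : Q, φ q x = x
  · exact Submodule.smul_mem _ _ (c.pt_mem_fixedPoints hx)
  · rw [c.brauerCoord_eq_zero hQ w hx, zero_smul]
    exact zero_mem _

theorem brauerMk_brauerSection (hQ : IsPGroup p Q) (w : BrauerQuotient ρ Q) :
    brauerMk ρ Q ⟨c.brauerSection hQ w, c.brauerSection_mem hQ w⟩ = w := by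
  classical
  obtain ⟨v, rfl⟩ := brauerMk_surjective Q w
  refine (brauerMk_eq_iff.2 ?_).symm
  have h := c.sum_sub_sum_fixed_mem_trace v.2 c.pt fun q x => c.apply_pt q x
  rw [c.sum_coord] at h
  simp only [brauerSection_apply, brauerCoord_mk]
  exact h

open Classical in
/-- `V(Q)` is a direct summand of the permutation module on the fixed points of `Q`; here the
coordinates and the vectors at the other points of `Ω` are zero. -/
noncomputable def brauer (hQ : IsPGroup p Q) :
    PermCoords (brauerRepCentralizer ρ Q)
      (φ.comp (Subgroup.centralizer (Q : Set X)).subtype) where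
  coord := c.brauerCoord hQ
  pt x := if h : ∀ q : Q, φ q x = x then brauerMk ρ Q ⟨c.pt x, c.pt_mem_fixedPoints h⟩ else 0
  coord_apply g w x := by
    obtain ⟨v, rfl⟩ := brauerMk_surjective Q w
    rw [brauerRepCentralizer_mk, brauerCoord_mk, brauerCoord_mk]
    have hiff : (∀ q : Q, φ q ((φ.comp (Subgroup.centralizer (Q : Set X)).subtype) g x) =
        (φ.comp (Subgroup.centralizer (Q : Set X)).subtype) g x) ↔ ∀ q : Q, φ q x = x :=
      map_mem_fixed_iff g x
    by_cases hx : ∀ q : Q, φ q x = x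
    · rw [if_pos hx, if_pos (hiff.2 hx)]
      exact c.coord_apply _ _ _
    · rw [if_neg hx, if_neg (hiff.not.2 hx)]
  apply_pt g x := by
    have hiff : (∀ q : Q, φ q ((φ.comp (Subgroup.centralizer (Q : Set X)).subtype) g x) =
        (φ.comp (Subgroup.centralizer (Q : Set X)).subtype) g x) ↔ ∀ q : Q, φ q x = x :=
      map_mem_fixed_iff g x
    by_cases hx : ∀ q : Q, φ q x = x
    · rw [dif_pos hx, dif_pos (hiff.2 hx), brauerRepCentralizer_mk]
      congr 2
      exact c.apply_pt _ _
    · rw [dif_neg hx, dif_neg (hiff.not.2 hx), map_zero]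
  sum_coord w := by
    conv_rhs => rw [← c.brauerMk_brauerSection hQ w]
    have h : (⟨c.brauerSection hQ w, c.brauerSection_mem hQ w⟩ : fixedPoints ρ Q) =
        ∑ x, c.brauerCoord hQ w x •
          if h : ∀ q : Q, φ q x = x then ⟨c.pt x, c.pt_mem_fixedPoints h⟩ else 0 := by
      refine Subtype.ext ?_
      rw [AddSubmonoidClass.coe_finsetSum]
      simp only [brauerSection_apply]
      refine Finset.sum_congr rfl fun x _ => ?_
      by_cases hx : ∀ q : Q, φ q x = x
      · rw [dif_pos hx]
        rfl
      · rw [dif_neg hx, c.brauerCoord_eq_zero hQ w hx, zero_smul, zero_smul]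
        rfl
    rw [h, map_sum]
    refine Finset.sum_congr rfl fun x _ => ?_
    rw [map_smul]
    congr 1
    by_cases hx : ∀ q : Q, φ q x = x
    · rw [dif_pos hx, dif_pos hx]
    · rw [dif_neg hx, dif_neg hx, map_zero]

theorem brauer_coord (hQ : IsPGroup p Q) : (c.brauer hQ).coord = c.brauerCoord hQ := rfl

theorem brauerSection_equivariant (hQ : IsPGroup p Q)
    (g : Subgroup.centralizer (Q : Set X)) (w : BrauerQuotient ρ Q) :
    c.brauerSection hQ (brauerRepCentralizer ρ Q g w) = ρ g (c.brauerSection hQ w) := by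
  rw [brauerSection_apply, brauerSection_apply, map_sum, ← Equiv.sum_comp (φ g)]
  refine Finset.sum_congr rfl fun x _ => ?_
  rw [map_smul, c.apply_pt]
  exact congrArg (· • _) ((c.brauer hQ).coord_apply g w x)

end PermCoords

end BrauerCoords

/-! ### Brauer quotients of bimodules -/

section BimoduleBrauer

variable {k : Type*} [Field k] {G H : Type*} [Group G] [Group H] {M : Type*} [AddCommGroup M]
  [Module k M]

/-- The embedding of the centralizer of the first projection of `Q` into the centralizer of
`Q ≤ G × H`. -/
def centralizerInl (Q : Subgroup (G × H)) :
    Subgroup.centralizer (Q.map (MonoidHom.fst G H) : Set G) →*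
      Subgroup.centralizer (Q : Set (G × H)) :=
  ((MonoidHom.inl G H).comp (Subgroup.subtype _)).codRestrict _ fun g =>
    Subgroup.mem_centralizer_iff.2 fun q hq => Prod.ext
      (Subgroup.mem_centralizer_iff.1 g.2 q.1 ⟨q, hq, rfl⟩) ((mul_one _).trans (one_mul _).symm)

/-- The embedding of the centralizer of the second projection of `Q` into the centralizer of
`Q ≤ G × H`. -/
def centralizerInr (Q : Subgroup (G × H)) :
    Subgroup.centralizer (Q.map (MonoidHom.snd G H) : Set H) →*
      Subgroup.centralizer (Q : Set (G × H)) :=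
  ((MonoidHom.inr G H).comp (Subgroup.subtype _)).codRestrict _ fun g =>
    Subgroup.mem_centralizer_iff.2 fun q hq => Prod.ext ((mul_one _).trans (one_mul _).symm)
      (Subgroup.mem_centralizer_iff.1 g.2 q.2 ⟨q, hq, rfl⟩)

variable [Finite G] [Finite H]

/-- The action of `C_G(Q₁)` on `M(Q)`, where `Q₁` is the first projection of `Q`. -/
noncomputable def brauerLeft (ρ : Representation k (G × H) M) (Q : Subgroup (G × H)) :
    Representation k (Subgroup.centralizer (Q.map (MonoidHom.fst G H) : Set G))
      (BrauerQuotient ρ Q) :=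
  (brauerRepCentralizer ρ Q).comp (centralizerInl Q)

/-- The action of `C_H(Q₂)` on `M(Q)`, where `Q₂` is the second projection of `Q`. -/
noncomputable def brauerRight (ρ : Representation k (G × H) M) (Q : Subgroup (G × H)) :
    Representation k (Subgroup.centralizer (Q.map (MonoidHom.snd G H) : Set H))
      (BrauerQuotient ρ Q) :=
  (brauerRepCentralizer ρ Q).comp (centralizerInr Q)

variable {ρ : Representation k (G × H) M}

theorem brauerLeft_comm_brauerRight (Q : Subgroup (G × H)) (g h) :
    brauerLeft ρ Q g * brauerRight ρ Q h = brauerRight ρ Q h * brauerLeft ρ Q g := by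
  change brauerRepCentralizer ρ Q (centralizerInl Q g) *
    brauerRepCentralizer ρ Q (centralizerInr Q h) = brauerRepCentralizer ρ Q (centralizerInr Q h) *
    brauerRepCentralizer ρ Q (centralizerInl Q g)
  rw [← map_mul, ← map_mul]
  congr 1
  exact Subtype.ext (Prod.ext ((mul_one _).trans (one_mul _).symm)
    ((one_mul _).trans (mul_one _).symm))

variable {Ω : Type*} [Fintype Ω] {φ : G × H →* Equiv.Perm Ω}
  {p : ℕ} [Fact p.Prime] [CharP k p] {Q : Subgroup (G × H)}

/-- If `G` acts freely on the basis, every `C_G(Q₁)`-endomorphism of `M(Q)` lifts to a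
`kG`-endomorphism of `M` that commutes with `Q`. -/
theorem exists_endomorphism_lift (c : PermCoords ρ φ)
    (hfree : ∀ (g : G) x, φ (g, 1) x = x → g = 1)
    (hQ : IsPGroup p Q) {θ : Module.End k (BrauerQuotient ρ Q)}
    (hθ : ∀ g, brauerLeft ρ Q g * θ = θ * brauerLeft ρ Q g) :
    ∃ T : Module.End k M, (∀ g, ρ (g, 1) * T = T * ρ (g, 1)) ∧ (∀ q ∈ Q, ρ q * T = T * ρ q) ∧
      ∀ v (hv : v ∈ fixedPoints ρ Q) (hTv : T v ∈ fixedPoints ρ Q),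
        brauerMk ρ Q ⟨T v, hTv⟩ = θ (brauerMk ρ Q ⟨v, hv⟩) := by
  classical
  let P : Ω → Prop := fun a => ∀ q : Q, φ q a = a
  -- The vectors of `M` that `T` assigns to the fixed points of `Q`.
  let b : Ω → M := fun a => c.brauerSection hQ (θ ((c.brauer hQ).pt a))
  have hbQ : ∀ a, b a ∈ fixedPoints ρ Q := fun a => c.brauerSection_mem hQ _
  have hmul : ∀ (x y : G × H) a, φ (x * y) a = φ x (φ y a) := fun x y a => by
    rw [map_mul, Equiv.Perm.mul_apply]
  have hρmul : ∀ (x y : G × H) m, ρ (x * y) m = ρ x (ρ y m) := fun x y m => by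
    rw [map_mul, Module.End.mul_apply]
  have hconj : ∀ (q : G × H) (g : G), q * (g, 1) = (q.1 * g * q.1⁻¹, 1) * q := by
    intro q g
    ext <;> simp
  -- Elements of `G` that relate two fixed points centralize `Q`.
  have hcent : ∀ (g : G) a, P a → P (φ (g, 1) a) →
      g ∈ Subgroup.centralizer (Q.map (MonoidHom.fst G H) : Set G) := by
    intro g a ha hga
    rw [Subgroup.mem_centralizer_iff]
    rintro _ ⟨q, hq, rfl⟩
    have h1 := hga ⟨q, hq⟩
    simp only at h1
    rw [← hmul, hconj, hmul, ha ⟨q, hq⟩] at h1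
    have h2 := hfree (g⁻¹ * (q.1 * g * q.1⁻¹)) a (by
      rw [show ((g⁻¹ * (q.1 * g * q.1⁻¹) : G), (1 : H)) = (g, 1)⁻¹ * (q.1 * g * q.1⁻¹, 1) by simp,
        hmul, h1, ← hmul, inv_mul_cancel, map_one, Equiv.Perm.one_apply])
    rw [inv_mul_eq_one] at h2
    change q.1 * g = g * q.1
    conv_rhs => rw [h2]
    simp
  have hbg : ∀ (g : G) a, P a → P (φ (g, 1) a) → b (φ (g, 1) a) = ρ (g, 1) (b a) := by
    intro g a ha hga
    have hg := hcent g a ha hga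
    have h1 := (c.brauer hQ).apply_pt (centralizerInl Q ⟨g, hg⟩) a
    have h2 := LinearMap.congr_fun (hθ ⟨g, hg⟩) ((c.brauer hQ).pt a)
    change brauerRepCentralizer ρ Q (centralizerInl Q ⟨g, hg⟩) (θ ((c.brauer hQ).pt a)) =
      θ (brauerRepCentralizer ρ Q (centralizerInl Q ⟨g, hg⟩) ((c.brauer hQ).pt a)) at h2
    rw [h1] at h2
    change c.brauerSection hQ (θ ((c.brauer hQ).pt (φ (g, 1) a))) = _
    refine Eq.trans ?_ (c.brauerSection_equivariant hQ (centralizerInl Q ⟨g, hg⟩) _)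
    rw [h2]
    rfl
  let E : Ω → M := fun x => if h : ∃ a, P a ∧ ∃ g : G, φ (g, 1) a = x
    then ρ (h.choose_spec.2.choose, 1) (b h.choose) else 0
  have hE : ∀ a (g : G), P a → E (φ (g, 1) a) = ρ (g, 1) (b a) := by
    intro a g ha
    have h : ∃ a', P a' ∧ ∃ g' : G, φ (g', 1) a' = φ (g, 1) a := ⟨a, ha, g, rfl⟩
    have hEx : E (φ (g, 1) a) = ρ (h.choose_spec.2.choose, 1) (b h.choose) := dif_pos h
    have ha' := h.choose_spec.1
    have hg' := h.choose_spec.2.choose_spec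
    rw [hEx]
    generalize h.choose_spec.2.choose = g' at *
    generalize h.choose = a' at *
    have h1 : a = φ (g⁻¹ * g', 1) a' := by
      rw [show ((g⁻¹ * g' : G), (1 : H)) = (g, 1)⁻¹ * (g', 1) by simp, hmul, hg', ← hmul,
        inv_mul_cancel, map_one, Equiv.Perm.one_apply]
    rw [h1] at ha ⊢
    rw [hbg _ _ ha' ha, ← hρmul]
    simp
  have hE0 : ∀ x, (¬ ∃ a, P a ∧ ∃ g : G, φ (g, 1) a = x) → E x = 0 := fun x h => dif_neg h
  -- `E` is equivariant for every element of the product that permutes the pairs used to define it.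
  have hEg : ∀ (g : G) x, ρ (g, 1) (E x) = E (φ (g, 1) x) := by
    intro g x
    by_cases h : ∃ a, P a ∧ ∃ g : G, φ (g, 1) a = x
    · obtain ⟨a, ha, g', rfl⟩ := h
      rw [hE a g' ha, ← hρmul, ← hmul, Prod.mk_mul_mk, one_mul, hE a _ ha]
    · rw [hE0 x h, hE0, map_zero]
      rintro ⟨a, ha, g', hg'⟩
      refine h ⟨a, ha, g⁻¹ * g', ?_⟩
      rw [show ((g⁻¹ * g' : G), (1 : H)) = (g, 1)⁻¹ * (g', 1) by simp, hmul, hg', ← hmul,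
        inv_mul_cancel, map_one, Equiv.Perm.one_apply]
  have hEQ : ∀ (q : Q) x, ρ q (E x) = E (φ q x) := by
    intro q x
    by_cases h : ∃ a, P a ∧ ∃ g : G, φ (g, 1) a = x
    · obtain ⟨a, ha, g, rfl⟩ := h
      rw [hE a g ha, ← hρmul, ← hmul, hconj, hρmul, hmul, ha q, hE a _ ha,
        mem_fixedPoints.1 (hbQ a) q q.2]
    · rw [hE0 x h, hE0, map_zero]
      rintro ⟨a, ha, g, hg⟩
      refine h ⟨a, ha, (q⁻¹ : Q).1.1 * g * (q⁻¹ : Q).1.1⁻¹, ?_⟩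
      have h1 := congrArg (φ (q⁻¹ : Q)) hg
      rw [← hmul, hconj, hmul, ha q⁻¹, ← hmul, ← Subgroup.coe_mul, inv_mul_cancel,
        Subgroup.coe_one, map_one, Equiv.Perm.one_apply] at h1
      exact h1
  let T : Module.End k M := ∑ x, (LinearMap.proj x ∘ₗ c.coord).smulRight (E x)
  have hT : ∀ v, T v = ∑ x, c.coord v x • E x := fun v => by simp [T, LinearMap.sum_apply]
  have hTcomm : ∀ y : G × H, (∀ x, ρ y (E x) = E (φ y x)) → ρ y * T = T * ρ y := by
    intro y hy
    refine LinearMap.ext fun v => ?_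
    rw [Module.End.mul_apply, Module.End.mul_apply, hT, hT, map_sum,
      ← Equiv.sum_comp (φ y) (fun x => c.coord (ρ y v) x • E x)]
    refine Finset.sum_congr rfl fun x _ => ?_
    rw [map_smul, hy, c.coord_apply]
  refine ⟨T, fun g => hTcomm _ (hEg g), fun q hq => hTcomm _ (hEQ ⟨q, hq⟩), ?_⟩
  intro v hv hTv
  -- Modulo traces only the coordinates at the fixed points of `Q` contribute to `T v`.
  have h1 : c.brauerSection hQ (θ (brauerMk ρ Q ⟨v, hv⟩)) =
      ∑ x, (if ∀ q : Q, φ q x = x then c.coord v x else 0) • E x := by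
    conv_lhs => rw [← (c.brauer hQ).sum_coord (brauerMk ρ Q ⟨v, hv⟩)]
    rw [map_sum, map_sum]
    refine Finset.sum_congr rfl fun x _ => ?_
    rw [map_smul, map_smul, c.brauer_coord, c.brauerCoord_mk]
    by_cases hx : ∀ q : Q, φ q x = x
    · rw [if_pos hx]
      congr 1
      have h2 := hE x 1 hx
      rw [show ((1 : G), (1 : H)) = 1 from rfl, map_one, map_one, Module.End.one_apply,
        Equiv.Perm.one_apply] at h2
      rw [h2]
    · rw [if_neg hx, zero_smul, zero_smul]
  rw [← c.brauerMk_brauerSection hQ (θ (brauerMk ρ Q ⟨v, hv⟩)), brauerMk_eq_iff]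
  have h2 := c.sum_sub_sum_fixed_mem_trace hv E hEQ
  rw [← hT, ← h1] at h2
  exact h2

/-- The restriction `kH → kC` of functions to a subgroup. -/
noncomputable def restrictCoeff (C : Subgroup H) (a : MonoidAlgebra k H) : MonoidAlgebra k C :=
  .ofCoeff (Finsupp.equivFunOnFinite.symm fun c => a.coeff c)

omit [Finite G] in
/-- An element `z` of `kH` that is fixed under conjugation by `Q` acts on `M(Q)` as its image under
the Brauer map. -/
theorem brauerMk_rightRep {z : MonoidAlgebra k H}
    (hz : ConjInvariant (Q.map (MonoidHom.snd G H) : Set H) z) [Finite G] {v : M}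
    (hv : v ∈ fixedPoints ρ Q) :
    ∃ h : (rightRep ρ).asAlgebraHom z v ∈ fixedPoints ρ Q,
      brauerMk ρ Q ⟨(rightRep ρ).asAlgebraHom z v, h⟩ =
        (brauerRight ρ Q).asAlgebraHom (restrictCoeff _ z) (brauerMk ρ Q ⟨v, hv⟩) := by
  classical
  have := Fintype.ofFinite H
  set C := Subgroup.centralizer (Q.map (MonoidHom.snd G H) : Set H) with hC
  let F : H → M := fun h => z.coeff h • ρ (1, h) v
  let ψ : Q →* Equiv.Perm H :=
    (MulAut.toPerm H).comp (MulAut.conj.comp ((MonoidHom.snd G H).comp Q.subtype))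
  have hψ : ∀ (q : Q) h, ψ q h = q.1.2 * h * q.1.2⁻¹ := fun _ _ => rfl
  have hF : ∀ (q : Q) h, ρ q (F h) = F (ψ q h) := by
    intro q h
    have h1 : (q : G × H) * ((1 : G), h) = ((1 : G), q.1.2 * h * q.1.2⁻¹) * (q : G × H) := by
      ext <;> simp
    have hzq : z.coeff (q.1.2 * h * q.1.2⁻¹) = z.coeff h := hz _ ⟨q, q.2, rfl⟩ h
    simp only [F, hψ, map_smul]
    rw [hzq, ← Module.End.mul_apply, ← map_mul, h1, map_mul, Module.End.mul_apply,
      mem_fixedPoints.1 hv q q.2]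
  have hsum : (rightRep ρ).asAlgebraHom z v = ∑ h, F h := by
    rw [Representation.asAlgebraHom_def, MonoidAlgebra.lift_apply, Finsupp.sum_fintype _ _ (by simp),
      LinearMap.sum_apply]
    rfl
  have hfix : ∀ h, (∀ q, ψ q h = h) ↔ h ∈ C := by
    intro h
    rw [hC, Subgroup.mem_centralizer_iff]
    constructor
    · rintro hh _ ⟨q, hq, rfl⟩
      exact mul_inv_eq_iff_eq_mul.1 (hh ⟨q, hq⟩)
    · intro hh q
      exact mul_inv_eq_iff_eq_mul.2 (hh _ ⟨q, q.2, rfl⟩)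
  have hmem : (rightRep ρ).asAlgebraHom z v ∈ fixedPoints ρ Q := by
    rw [mem_fixedPoints]
    intro q hq
    rw [hsum, map_sum, ← Equiv.sum_comp (ψ ⟨q, hq⟩) F]
    exact Finset.sum_congr rfl fun h _ => hF ⟨q, hq⟩ h
  refine ⟨hmem, ?_⟩
  have hFC : ∀ h : C, F h ∈ fixedPoints ρ Q := fun h => mem_fixedPoints.2 fun q hq => by
    rw [hF ⟨q, hq⟩, (hfix h).2 h.2]
  have h1 : (brauerRight ρ Q).asAlgebraHom (restrictCoeff C z) (brauerMk ρ Q ⟨v, hv⟩) =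
      brauerMk ρ Q (∑ h : C, ⟨F h, hFC h⟩) := by
    rw [Representation.asAlgebraHom_def, MonoidAlgebra.lift_apply, Finsupp.sum_fintype _ _ (by simp),
      LinearMap.sum_apply, map_sum]
    refine Finset.sum_congr rfl fun h _ => ?_
    rfl
  rw [h1, brauerMk_eq_iff]
  have h2 := sum_ite_fixed_mem_traceSubmodule ρ Q ψ F hF
  convert h2 using 1
  change (rightRep ρ).asAlgebraHom z v -
    ((∑ h : C, ⟨F h, hFC h⟩ : fixedPoints ρ Q) : M) = _
  rw [AddSubmonoidClass.coe_finsetSum, hsum, sub_eq_iff_eq_add]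
  have h3 : ∑ h : C, F h = ∑ h, if h ∈ C then F h else 0 := by
    rw [← Finset.sum_filter]
    exact (Finset.sum_subtype _ (by simp) F).symm
  change _ = _ + ∑ h : C, F h
  rw [h3, ← Finset.sum_add_distrib]
  refine Finset.sum_congr rfl fun h _ => ?_
  by_cases hh : h ∈ C
  · rw [if_pos hh, if_pos ((hfix h).2 hh), zero_add]
  · rw [if_neg hh, if_neg ((hfix h).not.2 hh), add_zero]

end BimoduleBrauer

/-! ### Induced trivial modules -/

section Induced

variable {k : Type*} [Field k] {X : Type*} [Group X] {V W : Type*} [AddCommGroup V] [Module k V]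
  [AddCommGroup W] [Module k W] {ρ : Representation k X V} {σ : Representation k X W}

/-- A direct summand of a direct summand of a permutation module. -/
noncomputable def PermCoords.directSummand {Ω : Type*} [Fintype Ω] {φ : X →* Equiv.Perm Ω}
    (c : PermCoords σ φ) (ι : Representation.IntertwiningMap ρ σ)
    (π : Representation.IntertwiningMap σ ρ) (h : ∀ v, π (ι v) = v) : PermCoords ρ φ where
  coord := c.coord ∘ₗ ι.toLinearMap
  pt x := π (c.pt x)
  coord_apply g v x := by
    have h1 : ι (ρ g v) = σ g (ι v) := Representation.IntertwiningMap.isIntertwining _ _ ι g v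
    change c.coord (ι (ρ g v)) _ = c.coord (ι v) x
    rw [h1, c.coord_apply]
  apply_pt g x := by
    rw [← c.apply_pt]
    exact (Representation.IntertwiningMap.isIntertwining _ _ π g _).symm
  sum_coord v := by
    conv_rhs => rw [← h v, ← c.sum_coord (ι v)]
    change _ = π.toLinearMap _
    rw [map_sum]
    refine Finset.sum_congr rfl fun x _ => ?_
    rw [map_smul]
    rfl

variable (k) in
/-- The `k`-linear map on the induced module `k_D↑^X` that sends the class of `x ⊗ 1` to the
coset `x⁻¹ D`. -/
noncomputable def indCoord (D : Subgroup X) [DecidableEq (X ⧸ D)] :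
    Representation.IndV D.subtype (Representation.trivial k D k) →ₗ[k] (X ⧸ D) → k :=
  Representation.Coinvariants.lift _
    (TensorProduct.lift ((LinearMap.lsmul k ((X ⧸ D) → k)).flip ∘ₗ
      Finsupp.linearCombination k (fun x : X => Pi.single (QuotientGroup.mk x⁻¹ : X ⧸ D) (1 : k)) ∘ₗ
        (MonoidAlgebra.coeffLinearEquiv k).toLinearMap))
    fun d => by
      ext x
      simp

theorem indCoord_mk (D : Subgroup X) [DecidableEq (X ⧸ D)] (x : X) (a : k) :
    indCoord k D (Representation.IndV.mk D.subtype (Representation.trivial k D k) x a) =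
      a • Pi.single (QuotientGroup.mk x⁻¹ : X ⧸ D) (1 : k) := by
  simp [indCoord]

theorem indV_mk_eq (D : Subgroup X) {x y : X}
    (h : (QuotientGroup.mk x⁻¹ : X ⧸ D) = QuotientGroup.mk y⁻¹) :
    Representation.IndV.mk D.subtype (Representation.trivial k D k) x 1 =
      Representation.IndV.mk D.subtype (Representation.trivial k D k) y 1 := by
  rw [QuotientGroup.eq, inv_inv] at h
  have h1 := Representation.Coinvariants.mk_self_apply
    (Representation.tprod ((Representation.leftRegular k X).comp D.subtype)
      (Representation.trivial k D k)) ⟨_, h⟩ (MonoidAlgebra.single y 1 ⊗ₜ (1 : k))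
  refine Eq.trans ?_ h1
  change Representation.Coinvariants.mk _ (MonoidAlgebra.single x 1 ⊗ₜ (1 : k)) = _
  congr 1
  change _ = Representation.leftRegular k X (x * y⁻¹) (MonoidAlgebra.single y 1) ⊗ₜ (1 : k)
  congr 1
  simp

open Classical in
/-- The module `k_D↑^X` is the permutation module on the cosets of `D`. -/
noncomputable def indPermCoords (D : Subgroup X) [Fintype (X ⧸ D)] :
    PermCoords (Representation.ind D.subtype (Representation.trivial k D k))
      (MulAction.toPermHom X (X ⧸ D)) where
  coord := indCoord k D
  pt ω := Representation.IndV.mk _ _ (Quotient.out ω)⁻¹ 1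
  coord_apply g v ω := by
    suffices h : LinearMap.proj (g • ω) ∘ₗ indCoord k D ∘ₗ
        Representation.ind D.subtype (Representation.trivial k D k) g =
        LinearMap.proj ω ∘ₗ indCoord k D from LinearMap.congr_fun h v
    refine Representation.IndV.hom_ext _ _ fun x => LinearMap.ext fun a => ?_
    change indCoord k D (Representation.ind D.subtype (Representation.trivial k D k) g
      (Representation.IndV.mk D.subtype (Representation.trivial k D k) x a)) (g • ω) =
      indCoord k D (Representation.IndV.mk D.subtype (Representation.trivial k D k) x a) ω
    rw [Representation.ind_mk, indCoord_mk, indCoord_mk]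
    have h1 : (QuotientGroup.mk (x * g⁻¹)⁻¹ : X ⧸ D) = g • QuotientGroup.mk x⁻¹ := by
      rw [mul_inv_rev, inv_inv]
      rfl
    rw [h1]
    simp only [Pi.smul_apply, Pi.single_apply, smul_left_cancel_iff]
  apply_pt g ω := by
    rw [Representation.ind_mk]
    refine indV_mk_eq D ?_
    have h1 : (QuotientGroup.mk (Quotient.out (g • ω)) : X ⧸ D) = g • ω := Quotient.out_eq' _
    have h2 : (QuotientGroup.mk (Quotient.out ω) : X ⧸ D) = ω := Quotient.out_eq' _
    rw [mul_inv_rev, inv_inv, inv_inv, inv_inv]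
    change _ = QuotientGroup.mk (Quotient.out (g • ω))
    rw [h1]
    conv_rhs => rw [← h2]
    rfl
  sum_coord v := by
    suffices h : ∑ ω, (LinearMap.proj ω ∘ₗ indCoord k D).smulRight
        (Representation.IndV.mk D.subtype (Representation.trivial k D k) (Quotient.out ω)⁻¹ 1) =
        LinearMap.id by
      have h1 := LinearMap.congr_fun h v
      rw [LinearMap.sum_apply] at h1
      exact h1
    refine Representation.IndV.hom_ext _ _ fun x => LinearMap.ext_ring ?_
    rw [LinearMap.comp_apply, LinearMap.sum_apply]
    simp only [LinearMap.smulRight_apply, LinearMap.comp_apply (f := LinearMap.proj _)]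
    rw [Finset.sum_eq_single (QuotientGroup.mk x⁻¹ : X ⧸ D)]
    · rw [indCoord_mk]
      simp only [LinearMap.proj_apply, one_smul, Pi.single_eq_same]
      refine indV_mk_eq D ?_
      rw [inv_inv]
      exact Quotient.out_eq' _
    · intro ω _ hω
      rw [indCoord_mk]
      simp only [LinearMap.proj_apply, one_smul, Pi.single_eq_of_ne hω, zero_smul]
    · intro h
      exact absurd (Finset.mem_univ _) h

end Induced

/-! ### Group algebras of subgroups -/

section Inclusion

variable {k : Type*} [Field k] {H : Type*} [Group H] (C : Subgroup H)

variable (k) in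
/-- The inclusion `kC → kH` for a subgroup `C ≤ H`. -/
noncomputable def subgroupAlgebraMap : MonoidAlgebra k C →ₐ[k] MonoidAlgebra k H :=
  MonoidAlgebra.mapDomainAlgHom k k C.subtype

theorem coeff_subgroupAlgebraMap (a : MonoidAlgebra k C) (c : C) :
    (subgroupAlgebraMap k C a).coeff c = a.coeff c :=
  Finsupp.mapDomain_apply C.subtype_injective a.coeff c

theorem coeff_subgroupAlgebraMap_of_notMem (a : MonoidAlgebra k C) {x : H} (hx : x ∉ C) :
    (subgroupAlgebraMap k C a).coeff x = 0 :=
  Finsupp.mapDomain_of_notMem_range a.coeff x (by simpa using hx)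

theorem subgroupAlgebraMap_injective : Function.Injective (subgroupAlgebraMap k C) :=
  MonoidAlgebra.mapDomain_injective C.subtype_injective

theorem augmentation_subgroupAlgebraMap (a : MonoidAlgebra k C) :
    augmentation k H (subgroupAlgebraMap k C a) = augmentation k C a := by
  induction a using MonoidAlgebra.induction_on with
  | of g => simp [augmentation, subgroupAlgebraMap]
  | add x y hx hy => rw [map_add, map_add, hx, hy, map_add]
  | smul r x hx => rw [map_smul, map_smul, hx, map_smul]

theorem subgroupAlgebraMap_restrictCoeff [Finite H] (Q : Subgroup H) (a : MonoidAlgebra k H) :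
    subgroupAlgebraMap k (Subgroup.centralizer (Q : Set H)) (restrictCoeff _ a) =
      brauerMap Q a := by
  ext x
  rw [coeff_brauerMap]
  by_cases hx : x ∈ Subgroup.centralizer (Q : Set H)
  · rw [if_pos hx]
    exact coeff_subgroupAlgebraMap _ _ ⟨x, hx⟩
  · rw [if_neg hx, coeff_subgroupAlgebraMap_of_notMem _ _ hx]

theorem conjInvariant_subgroupAlgebraMap {a : MonoidAlgebra k C} (ha : ∀ b, b * a = a * b) :
    ConjInvariant (C : Set H) (subgroupAlgebraMap k C a) := by
  rw [conjInvariant_iff]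
  intro g hg
  have h1 : MonoidAlgebra.of k H g =
      subgroupAlgebraMap k C (MonoidAlgebra.of k C ⟨g, hg⟩) := by
    simp [subgroupAlgebraMap]
  rw [h1, ← map_mul, ha, map_mul]

end Inclusion

/-! ### Brauer indecomposability -/

section Indecomposable

variable {k : Type*} [Field k] {G H : Type*} [Group G] [Group H] [Finite G] [Finite H]
  {M : Type*} [AddCommGroup M] [Module k M] {ρ : Representation k (G × H) M}
  {Ω : Type*} [Fintype Ω] {φ : G × H →* Equiv.Perm Ω}
  {p : ℕ} [Fact p.Prime] [CharP k p] {b : MonoidAlgebra k H}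

/-- If every `kG`-endomorphism of `M` comes from `kH`, then every `C_G(Q₁)`-endomorphism of `M(Q)`
comes from `kC_H(Q₂)`. -/
theorem exists_brauerRight_eq (c : PermCoords ρ φ)
    (hG : ∀ (g : G) x, φ (g, 1) x = x → g = 1)
    (hb : ConjInvariant Set.univ b) (hb2 : b * b = b) (hbM : (rightRep ρ).asAlgebraHom b = 1)
    (hsurj : ∀ T : Module.End k M, (∀ g, ρ (g, 1) * T = T * ρ (g, 1)) →
      ∃ z, (rightRep ρ).asAlgebraHom z = T)
    (hann : ∀ z, (rightRep ρ).asAlgebraHom z = 0 → z * b = 0)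
    {Q : Subgroup (G × H)} (hQ : IsPGroup p Q) {θ : Module.End k (BrauerQuotient ρ Q)}
    (hθ : ∀ g, brauerLeft ρ Q g * θ = θ * brauerLeft ρ Q g) :
    ∃ a, (brauerRight ρ Q).asAlgebraHom a = θ := by
  obtain ⟨T, hTG, hTQ, hT⟩ := exists_endomorphism_lift c hG hQ hθ
  obtain ⟨z, hz⟩ := hsurj T hTG
  have hzb : (rightRep ρ).asAlgebraHom (z * b) = T := by rw [map_mul, hbM, mul_one, hz]
  -- `kHb` acts faithfully on `M`, so `z * b` inherits the invariance of `T` under `Q`.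
  have hinv : ConjInvariant (Q.map (MonoidHom.snd G H) : Set H) (z * b) := by
    rw [conjInvariant_iff]
    rintro _ ⟨q, hq, rfl⟩
    have h1 : rightRep ρ q.2 = ρ (q.1⁻¹, 1) * ρ q := by
      rw [← map_mul]
      change ρ (1, q.2) = _
      congr 1
      ext <;> simp
    have h2 : rightRep ρ q.2 * T = T * rightRep ρ q.2 := by
      rw [h1, mul_assoc, hTQ q hq, ← mul_assoc, hTG, mul_assoc]
    have h3 := hann (MonoidAlgebra.of k H q.2 * (z * b) - z * b * MonoidAlgebra.of k H q.2) (by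
      rw [map_sub, map_mul _ (MonoidAlgebra.of k H q.2), map_mul _ (z * b), hzb, Representation.asAlgebraHom_of, h2, sub_self])
    rw [sub_mul, sub_eq_zero] at h3
    have h4 : z * b * b = z * b := by rw [mul_assoc, hb2]
    rw [mul_assoc, h4, mul_assoc (z * b),
      conjInvariant_univ_iff.1 hb (MonoidAlgebra.of k H q.2), ← mul_assoc (z * b),
      h4] at h3
    exact h3
  refine ⟨restrictCoeff _ (z * b), LinearMap.ext fun w => ?_⟩
  obtain ⟨⟨v, hv⟩, rfl⟩ := brauerMk_surjective Q w
  obtain ⟨h, h1⟩ := brauerMk_rightRep hinv hv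
  rw [← h1]
  simp only [hzb]
  exact hT v hv _

/-- Complementary projections of `M(Q)` lift to orthogonal central idempotents of `kC_H(Q₂)` below
`Br_{Q₂}(b)`.  At most one of them acts nontrivially on the trivial module, and the other vanishes
by Brauer's third main theorem. -/
theorem eq_zero_or_eq_one_of_commute (c : PermCoords ρ φ)
    (hG : ∀ (g : G) x, φ (g, 1) x = x → g = 1) (hH : ∀ (h : H) x, φ (1, h) x = x → h = 1)
    (hb : ConjInvariant Set.univ b) (hb2 : b * b = b)
    (hprim : ∀ E : MonoidAlgebra k H, ConjInvariant Set.univ E → E * E = E → E * b = E →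
      E = 0 ∨ E = b)
    (hε : augmentation k H b = 1) (hbM : (rightRep ρ).asAlgebraHom b = 1)
    (hsurj : ∀ T : Module.End k M, (∀ g, ρ (g, 1) * T = T * ρ (g, 1)) →
      ∃ z, (rightRep ρ).asAlgebraHom z = T)
    (hann : ∀ z, (rightRep ρ).asAlgebraHom z = 0 → z * b = 0)
    {Q : Subgroup (G × H)} (hQ : IsPGroup p Q) {θ : Module.End k (BrauerQuotient ρ Q)}
    (hθ : ∀ x, brauerRepCentralizer ρ Q x * θ = θ * brauerRepCentralizer ρ Q x)
    (hθ2 : θ * θ = θ) : θ = 0 ∨ θ = 1 := by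
  have := Fintype.ofFinite (Subgroup.centralizer (Q.map (MonoidHom.fst G H) : Set G))
  have := Fintype.ofFinite (Subgroup.centralizer (Q.map (MonoidHom.snd G H) : Set H))
  obtain ⟨κ, hκ⟩ := ((c.brauer hQ).restrict (τ := brauerLeft ρ Q) (centralizerInl Q)
    fun _ => rfl).exists_sum_conj_eq_one fun g x hx => Subtype.ext (hG g x hx)
  obtain ⟨ν, hν⟩ := ((c.brauer hQ).restrict (τ := brauerRight ρ Q) (centralizerInr Q)
    fun _ => rfl).exists_sum_conj_eq_one fun h x hx => Subtype.ext (hH h x hx)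
  obtain ⟨s, hs, hs'⟩ := exists_central_lift (brauerLeft ρ Q) (brauerRight ρ Q)
    (brauerLeft_comm_brauerRight Q) hκ hν fun θ hθ =>
      exists_brauerRight_eq c hG hb hb2 hbM hsurj hann hQ hθ
  have hx : (brauerRight ρ Q).asAlgebraHom (restrictCoeff _ b) = 1 := by
    refine LinearMap.ext fun w => ?_
    obtain ⟨⟨v, hv⟩, rfl⟩ := brauerMk_surjective Q w
    obtain ⟨h, h1⟩ := brauerMk_rightRep
      (hb.mono (Set.subset_univ (Q.map (MonoidHom.snd G H) : Set H))) hv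
    rw [← h1]
    simp only [hbM]
    rfl
  -- An idempotent bimodule endomorphism whose lift acts as zero on the trivial module vanishes.
  have key : ∀ ψ : Module.End k (BrauerQuotient ρ Q),
      (∀ x, brauerRepCentralizer ρ Q x * ψ = ψ * brauerRepCentralizer ρ Q x) → ψ * ψ = ψ →
      augmentation k _ (s ψ) = 0 → ψ = 0 := by
    intro ψ hψ hψ2 hψε
    have hl : ∀ g, brauerLeft ρ Q g * ψ = ψ * brauerLeft ρ Q g := fun g => hψ _
    obtain ⟨h1, h2, h3⟩ := hs' ψ hl fun h => hψ _
    have h4 : IsNonprincipalBelow b (Q.map (MonoidHom.snd G H))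
        (subgroupAlgebraMap k _ (s ψ)) :=
      { support := fun x hx => coeff_subgroupAlgebraMap_of_notMem _ _ hx
        invariant := conjInvariant_subgroupAlgebraMap _ h1
        idem := by rw [← map_mul, ← h2, hψ2]
        below := by rw [← subgroupAlgebraMap_restrictCoeff, ← map_mul, h3 _ hx]
        aug := by rw [augmentation_subgroupAlgebraMap, hψε] }
    have h5 := IsNonprincipalBelow.eq_zero hb hb2 hprim hε (hQ.map (MonoidHom.snd G H)) h4
    have h6 : s ψ = 0 := subgroupAlgebraMap_injective _ (by rw [h5, map_zero])
    rw [← hs ψ hl, h6, map_zero]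
  have hprod : θ * (1 - θ) = 0 := by rw [mul_sub, mul_one, hθ2, sub_self]
  have h1 : s θ * s (1 - θ) = 0 := by
    rw [← (hs' θ (fun g => hθ _) fun h => hθ _).2.1, hprod, map_zero]
  have h2 := congrArg (augmentation k _) h1
  rw [map_mul, map_zero] at h2
  rcases mul_eq_zero.1 h2 with h | h
  · exact .inl (key θ hθ hθ2 h)
  · refine .inr (sub_eq_zero.1 (key (1 - θ) (fun x => ?_) ?_ h)).symm
    · rw [mul_sub, sub_mul, hθ, mul_one, one_mul]
    · rw [sub_mul, one_mul, hprod, sub_zero]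

/-- A nonzero representation whose only idempotent endomorphisms are `0` and `1` is
indecomposable. -/
theorem isIndecomposable_of_idempotents {X V : Type*} [Group X] [AddCommGroup V] [Module k V]
    [Nontrivial V] {τ : Representation k X V}
    (h : ∀ θ : Module.End k V, (∀ x, τ x * θ = θ * τ x) → θ * θ = θ → θ = 0 ∨ θ = 1) :
    IsIndecomposable τ := by
  refine ⟨inferInstance, fun Y Z hYZ => ?_⟩
  have hc : IsCompl Y.toSubmodule Z.toSubmodule := by
    constructor
    · rw [disjoint_iff]
      exact congrArg Subrepresentation.toSubmodule hYZ.inf_eq_bot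
    · rw [codisjoint_iff]
      exact congrArg Subrepresentation.toSubmodule hYZ.sup_eq_top
  have hker : ∀ v, Y.toSubmodule.projection Z.toSubmodule hc v = 0 ↔ v ∈ Z.toSubmodule :=
    fun v => Submodule.projection_apply_eq_zero_iff hc
  have hY : ∀ v ∈ Y.toSubmodule, Y.toSubmodule.projection Z.toSubmodule hc v = v :=
    fun v hv => Submodule.projection_apply_of_mem_left hc hv
  have hZ : ∀ v ∈ Z.toSubmodule, Y.toSubmodule.projection Z.toSubmodule hc v = 0 :=
    fun v hv => (hker v).2 hv
  have hmem : ∀ v, Y.toSubmodule.projection Z.toSubmodule hc v ∈ Y.toSubmodule :=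
    Submodule.projection_apply_mem hc
  have hsum : ∀ v, ∃ y ∈ Y.toSubmodule, ∃ z ∈ Z.toSubmodule, y + z = v := fun v =>
    Submodule.mem_sup.1 (hc.sup_eq_top ▸ Submodule.mem_top)
  generalize Y.toSubmodule.projection Z.toSubmodule hc = θ at *
  have hθ : ∀ x, τ x * θ = θ * τ x := fun x => LinearMap.ext fun v => by
    obtain ⟨y, hy, z, hz, rfl⟩ := hsum v
    rw [Module.End.mul_apply, Module.End.mul_apply, map_add θ, map_add (τ x), map_add (τ x),
      map_add θ, hY y hy, hZ z hz, hY _ (Y.apply_mem_toSubmodule x hy),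
      hZ _ (Z.apply_mem_toSubmodule x hz), map_zero]
  rcases h θ hθ (LinearMap.ext fun v => hY _ (hmem v)) with h | h
  · left
    refine Subrepresentation.toSubmodule_injective ((Submodule.eq_bot_iff _).2 fun v hv => ?_)
    rw [← hY v hv, h, LinearMap.zero_apply]
  · right
    refine Subrepresentation.toSubmodule_injective ((Submodule.eq_bot_iff _).2 fun v hv => ?_)
    rw [← hZ v hv, h, Module.End.one_apply]

end Indecomposable

/-! ### Principal block idempotents -/

section PrincipalBlock

variable {k : Type*} [Field k] {G : Type*} [Group G]
  {e : Subalgebra.center k (MonoidAlgebra k G)}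

theorem IsPrincipalBlockIdempotent.augmentation_eq_one (he : IsPrincipalBlockIdempotent e) :
    augmentation k G (e : MonoidAlgebra k G) = 1 := by
  have h : ∀ a : MonoidAlgebra k G,
      (Representation.trivial k G k).asAlgebraHom a 1 = augmentation k G a := by
    intro a
    induction a using MonoidAlgebra.induction_on with
    | of g => rw [Representation.asAlgebraHom_of]; simp [augmentation]
    | add x y hx hy => rw [map_add, LinearMap.add_apply, hx, hy, map_add]
    | smul r x hx => rw [map_smul, LinearMap.smul_apply, hx, map_smul]
  rw [← h, he.acts_on_trivial, Module.End.one_apply]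

theorem IsPrincipalBlockIdempotent.mul_self (he : IsPrincipalBlockIdempotent e) :
    (e : MonoidAlgebra k G) * e = e := congrArg Subtype.val he.idempotent

theorem conjInvariant_center : ConjInvariant Set.univ (e : MonoidAlgebra k G) :=
  conjInvariant_univ_iff.2 (Subalgebra.mem_center_iff.1 e.2)

theorem IsPrincipalBlockIdempotent.eq_zero_or_eq (he : IsPrincipalBlockIdempotent e)
    {E : MonoidAlgebra k G} (hE : ConjInvariant Set.univ E) (hE2 : E * E = E)
    (hEe : E * (e : MonoidAlgebra k G) = E) : E = 0 ∨ E = e := by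
  let E' : Subalgebra.center k (MonoidAlgebra k G) :=
    ⟨E, Subalgebra.mem_center_iff.2 (conjInvariant_univ_iff.1 hE)⟩
  have h1 : (e : MonoidAlgebra k G) * E = E := by rw [conjInvariant_univ_iff.1 hE, hEe]
  rcases he.primitive E' (e - E') (Subtype.ext hE2)
    (Subtype.ext (by
      change (e - E : MonoidAlgebra k G) * (e - E) = e - E
      rw [mul_sub, sub_mul, sub_mul, hE2, hEe, he.mul_self, h1, sub_self, sub_zero]))
    (Subtype.ext (by
      change E * (e - E : MonoidAlgebra k G) = 0
      rw [mul_sub, hE2, hEe, sub_self]))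
    (add_sub_cancel _ _).symm with h | h
  · exact .inl (congrArg Subtype.val h)
  · exact .inr (congrArg Subtype.val (sub_eq_zero.1 h)).symm

theorem IsPrincipalBlockIdempotent.invMap_eq_zero_or_eq (he : IsPrincipalBlockIdempotent e)
    {E : MonoidAlgebra k G} (hE : ConjInvariant Set.univ E) (hE2 : E * E = E)
    (hEe : E * invMap k G (e : MonoidAlgebra k G) = E) :
    E = 0 ∨ E = invMap k G (e : MonoidAlgebra k G) := by
  rcases he.eq_zero_or_eq (E := invMap k G E) hE.invMap (by rw [← invMap_mul, hE2])
    (by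
      rw [← conjInvariant_univ_iff.1 hE.invMap, ← invMap_invMap (e : MonoidAlgebra k G),
        ← invMap_mul, hEe]) with h | h
  · left
    rw [← invMap_invMap E, h, map_zero]
  · right
    rw [← h, invMap_invMap]

end PrincipalBlock

/-! ### Scott modules with diagonal vertices -/

section Scott

variable {G H P : Type*} [Group G] [Group H] [Group P]

theorem eq_one_of_left_smul_coset {i : P →* G} {j : P →* H} (hj : Function.Injective j) {g : G}
    {x : (G × H) ⧸ diagonal i j} (h : ((g, 1) : G × H) • x = x) : g = 1 := by
  induction x using QuotientGroup.induction_on with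
  | H x =>
    obtain ⟨y, hy⟩ := QuotientGroup.eq.1 h.symm
    have h2 : j y = 1 := (congrArg Prod.snd hy).trans (by simp)
    have h1 : i y = x.1⁻¹ * (g * x.1) := congrArg Prod.fst hy
    rw [(map_eq_one_iff j hj).1 h2, map_one, eq_comm, inv_mul_eq_one] at h1
    simpa using h1.symm

theorem eq_one_of_right_smul_coset {i : P →* G} {j : P →* H} (hi : Function.Injective i) {g : H}
    {x : (G × H) ⧸ diagonal i j} (h : ((1, g) : G × H) • x = x) : g = 1 := by
  induction x using QuotientGroup.induction_on with
  | H x =>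
    obtain ⟨y, hy⟩ := QuotientGroup.eq.1 h.symm
    have h2 : i y = 1 := (congrArg Prod.fst hy).trans (by simp)
    have h1 : j y = x.2⁻¹ * (g * x.2) := congrArg Prod.snd hy
    rw [(map_eq_one_iff i hi).1 h2, map_one, eq_comm, inv_mul_eq_one] at h1
    simpa using h1.symm

/-- A direct summand of `k_{ΔP}↑^{G × H}` that induces a Morita equivalence between the principal
blocks is Brauer indecomposable. -/
theorem isBrauerIndecomposable_of_morita {k : Type*} [Field k] {p : ℕ} [Fact p.Prime] [CharP k p]
    [Finite G] [Finite H] {i : P →* G} {j : P →* H} (hi : Function.Injective i)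
    (hj : Function.Injective j) {M : Type*} [AddCommGroup M] [Module k M]
    {ρ : Representation k (G × H) M}
    (hρ : IsDirectSummand ρ (Representation.ind (diagonal i j).subtype
      (Representation.trivial k (diagonal i j) k)))
    {e : Subalgebra.center k (MonoidAlgebra k G)} {f : Subalgebra.center k (MonoidAlgebra k H)}
    (hf : IsPrincipalBlockIdempotent f) (hM : InducesMoritaEquivalence e f ρ) :
    IsBrauerIndecomposable p ρ := by
  have := Fintype.ofFinite ((G × H) ⧸ diagonal i j)
  obtain ⟨ι, π, h⟩ := hρ
  obtain ⟨hbim, N, _, _, _, σ, -, ⟨Φ⟩, ⟨Ψ⟩⟩ := hM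
  intro Q hQ
  rcases subsingleton_or_nontrivial (BrauerQuotient ρ Q) with hs | hn
  · exact .inr hs
  refine .inl (isIndecomposable_of_idempotents fun θ hθ hθ2 =>
    eq_zero_or_eq_one_of_commute ((indPermCoords (diagonal i j)).directSummand ι π h)
      (fun g x hx => eq_one_of_left_smul_coset hj hx)
      (fun g x hx => eq_one_of_right_smul_coset hi hx)
      (b := invMap k H f) conjInvariant_center.invMap (by rw [← invMap_mul, hf.mul_self])
      (fun E => hf.invMap_eq_zero_or_eq)
      (by rw [augmentation_invMap, hf.augmentation_eq_one])
      (LinearMap.ext fun m => ?_)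
      (fun T hT => exists_asAlgebraHom_eq hf.idempotent Φ Ψ (fun m => (hbim m).1) hT)
      (fun z hz => mul_eq_zero_of_annihilates Ψ hz) hQ hθ hθ2)
  rw [← rightAct_unop]
  exact (hbim m).2

end Scott
end BlockTheory

open BlockTheory in
theorem lemma2p2 :
    (∀ (p : ℕ) [Fact p.Prime] (k : Type u) [Field k] [IsAlgClosed k] [CharP k p]
      (G : Type v₁) [Group G] [Finite G] (H : Type v₂) [Group H] [Finite H]
      (P : Type v₃) [Group P] (i : P →* G) (j : P →* H),
      IsSylowEmbedding p i → IsSylowEmbedding p j →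
      ∀ (M : Type w) [AddCommGroup M] [Module k M] (ρ : Representation k (G × H) M),
        IsScottModule ρ (diagonal i j) →
        InducesSplendidMoritaEquivalencePrincipal p ρ →
        IsBrauerIndecomposable p ρ) ∧
    (∀ (n : ℕ), 3 ≤ n → ∀ (k : Type u) [Field k] [IsAlgClosed k] [CharP k 2]
      (G : Type v₁) [Group G] [Finite G] (H : Type v₂) [Group H] [Finite H]
      (P : Type v₃) [Group P], Nonempty (P ≃* QuaternionGroup (2 ^ (n - 2))) →
      ∀ (i : P →* G) (j : P →* H), IsSylowEmbedding 2 i → IsSylowEmbedding 2 j →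
      IsQuaternionModelGroup H →
      ∀ (M : Type w) [AddCommGroup M] [Module k M] (ρ : Representation k (G × H) M),
        IsScottModule ρ (diagonal i j) →
        InducesSplendidMoritaEquivalencePrincipal 2 ρ →
        IsBrauerIndecomposable 2 ρ) := by
  refine ⟨?_, ?_⟩
  · intro p _ k _ _ _ G _ _ H _ _ P _ i j hi hj M _ _ ρ hρ hM
    obtain ⟨⟨e, f, -, hf, hM⟩, -⟩ := hM
    exact isBrauerIndecomposable_of_morita hi.1 hj.1 hρ.2.1 hf hM
  · intro n _ k _ _ _ G _ _ H _ _ P _ _ i j hi hj _ M _ _ ρ hρ hM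
    obtain ⟨⟨e, f, -, hf, hM⟩, -⟩ := hM
    exact isBrauerIndecomposable_of_morita hi.1 hj.1 hρ.2.1 hf hM
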